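/- Let $q\ge 2$ and $n\ge 0$. Let $SU(1,q)$ be the group of complex matrices of determinant $1$ preserving the Hermitian form $h(x,y)=\bar x_0y_0-\sum_{i=1}^{q}\bar x_iy_i$ on $\mathbb{C}^{1+q}$, and let $SO(2,n)$ be the group of real matrices of determinant $1$ preserving the symmetric bilinear form $b(v,w)=v_1w_1+v_2w_2-\sum_{j=3}^{n+2}v_jw_j$ on $\mathbb{R}^{2+n}$. Then every non-trivial continuous group homomorphism $\rho\colon SU(1,q)\to SO(2,n)$ comes from the standard representation of $SU(1,q)$ on $\mathbb{C}^{1+q}$, that is: there is an $\mathbb{R}$-linear map $\varphi\colon\mathbb{C}^{1+q}\to\mathbb{R}^{2+n}$ such that $b(\varphi(x),\varphi(y))=\operatorname{Re}h(x,y)$ and $\varphi(Ax)=\rho(A)\varphi(x)$ for all $x,y\in\mathbb{C}^{1+q}$ and $A\in SU(1,q)$, and such that $\rho(A)v=v$ for every $A\in SU(1,q)$ and every $v\in\mathbb{R}^{2+n}$ that is $b$-orthogonal to the image of $\varphi$. In other words, $\mathbb{R}^{2+n}$ is the orthogonal direct sum of the standard representation $(\mathbb{C}^{1+q},\operatorname{Re}h)$,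 regarded as a real representation, and a trivial representation. -/

import Mathlib

open Matrix

/-- The signature matrix `diag(1, …, 1, -1, …, -1)` with `p` entries `1` and `q` entries `-1`. -/
abbrev sigMatrix (R : Type*) [CommRing R] (p q : ℕ) : Matrix (Fin p ⊕ Fin q) (Fin p ⊕ Fin q) R :=
  LieAlgebra.Orthogonal.indefiniteDiagonal (Fin p) (Fin q) R

/-- The symmetric bilinear form of signature `(p, q)` on `ℝ^(p+q)`. -/
def realForm (p q : ℕ) (x y : Fin p ⊕ Fin q → ℝ) : ℝ :=
  x ⬝ᵥ (sigMatrix ℝ p q *ᵥ y)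

/-- The Hermitian form of signature `(p, q)` on `ℂ^(p+q)`, conjugate-linear in the first
variable. -/
def hermForm (p q : ℕ) (x y : Fin p ⊕ Fin q → ℂ) : ℂ :=
  star x ⬝ᵥ (sigMatrix ℂ p q *ᵥ y)

/-- The group `SU(p, q)`: complex matrices of determinant `1` preserving the Hermitian form of
signature `(p, q)`, with the topology induced from the space of matrices. -/
def SU (p q : ℕ) : Subgroup (SpecialLinearGroup (Fin p ⊕ Fin q) ℂ) where
  carrier := {A | A.1ᴴ * sigMatrix ℂ p q * A.1 = sigMatrix ℂ p q}
  one_mem' := by simp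
  mul_mem' := by
    intro A B hA hB
    simp only [Set.mem_ofPred_eq] at hA hB ⊢
    calc (A * B).1ᴴ * sigMatrix ℂ p q * (A * B).1
        = B.1ᴴ * (A.1ᴴ * sigMatrix ℂ p q * A.1) * B.1 := by
          change (A.1 * B.1)ᴴ * _ * (A.1 * B.1) = _
          rw [conjTranspose_mul]; simp only [Matrix.mul_assoc]
      _ = _ := by rw [hA, hB]
  inv_mem' := by
    intro A hA
    simp only [Set.mem_ofPred_eq] at hA ⊢
    have h1 : A.1 * (A⁻¹).1 = 1 := congrArg Subtype.val (mul_inv_cancel A)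
    have h2 : (A⁻¹).1ᴴ * A.1ᴴ = 1 := by rw [← conjTranspose_mul, h1, conjTranspose_one]
    calc (A⁻¹).1ᴴ * sigMatrix ℂ p q * (A⁻¹).1
        = (A⁻¹).1ᴴ * (A.1ᴴ * sigMatrix ℂ p q * A.1) * (A⁻¹).1 := by rw [hA]
      _ = ((A⁻¹).1ᴴ * A.1ᴴ) * sigMatrix ℂ p q * (A.1 * (A⁻¹).1) := by
          simp only [Matrix.mul_assoc]
      _ = _ := by rw [h1, h2, Matrix.one_mul, Matrix.mul_one]

/-- The group `SO(p, q)`: real matrices of determinant `1` preserving the symmetric bilinear form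
of signature `(p, q)`, with the topology induced from the space of matrices. -/
def SO (p q : ℕ) : Subgroup (SpecialLinearGroup (Fin p ⊕ Fin q) ℝ) where
  carrier := {A | A.1ᵀ * sigMatrix ℝ p q * A.1 = sigMatrix ℝ p q}
  one_mem' := by simp
  mul_mem' := by
    intro A B hA hB
    simp only [Set.mem_ofPred_eq] at hA hB ⊢
    calc (A * B).1ᵀ * sigMatrix ℝ p q * (A * B).1
        = B.1ᵀ * (A.1ᵀ * sigMatrix ℝ p q * A.1) * B.1 := by
          change (A.1 * B.1)ᵀ * _ * (A.1 * B.1) = _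
          rw [transpose_mul]; simp only [Matrix.mul_assoc]
      _ = _ := by rw [hA, hB]
  inv_mem' := by
    intro A hA
    simp only [Set.mem_ofPred_eq] at hA ⊢
    have h1 : A.1 * (A⁻¹).1 = 1 := congrArg Subtype.val (mul_inv_cancel A)
    have h2 : (A⁻¹).1ᵀ * A.1ᵀ = 1 := by rw [← transpose_mul, h1, transpose_one]
    calc (A⁻¹).1ᵀ * sigMatrix ℝ p q * (A⁻¹).1
        = (A⁻¹).1ᵀ * (A.1ᵀ * sigMatrix ℝ p q * A.1) * (A⁻¹).1 := by rw [hA]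
      _ = ((A⁻¹).1ᵀ * A.1ᵀ) * sigMatrix ℝ p q * (A.1 * (A⁻¹).1) := by
          simp only [Matrix.mul_assoc]
      _ = _ := by rw [h1, h2, Matrix.one_mul, Matrix.mul_one]

/-- A homomorphism `ρ : SU(1, q) → SO(2, n)` comes from the standard representation of `SU(1, q)`
if `ℝ^(2+n)` is the orthogonal direct sum of a copy of the standard representation `ℂ^(1+q)`, taken
as a real vector space with the real part of its Hermitian form (and embedded by `φ`), and a
subspace on which `SU(1, q)` acts trivially. -/
def ComesFromStandard {q n : ℕ} (ρ : SU 1 q →* SO 2 n) : Prop :=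
  ∃ φ : (Fin 1 ⊕ Fin q → ℂ) →ₗ[ℝ] (Fin 2 ⊕ Fin n → ℝ),
    (∀ x y, realForm 2 n (φ x) (φ y) = (hermForm 1 q x y).re) ∧
    (∀ (A : SU 1 q) (x : Fin 1 ⊕ Fin q → ℂ), φ (A.1.1 *ᵥ x) = (ρ A).1.1 *ᵥ φ x) ∧
    (∀ (A : SU 1 q) (v : Fin 2 ⊕ Fin n → ℝ),
      (∀ x, realForm 2 n v (φ x) = 0) → (ρ A).1.1 *ᵥ v = v)

/-!
The proof stays at the level of the groups. For an isotropic vector `e` and `u ⟂ e`, the Eichler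
transformations `eichler e u s` of `SU(1, q)` form a Heisenberg group with centre `eichler e 0 s`.
Together with the opposite Heisenberg group, attached to an isotropic `f` with `h(e, f) = 1`, they
generate `SU(1, q)` (`HypPair.eq_top_of_eichler_mem`), and a single central element already
generates it as a normal subgroup (`HypPair.eq_top_of_normal`). The boosts `e ↦ r e`,
`f ↦ r⁻¹ f` contract an Eichler transformation to the identity by conjugation, so by continuity a
representation `R` in `SO(2, n)` sends it to a unipotent matrix (`isNilpotent_toRep_eichler`).

A central element is a commutator of unipotent isometries which commute with it. In a quadratic
space without nonnegative subspaces of dimension three this forces `Y = R(eichler e 0 1) - 1` to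
have square zero (`sub_one_sq_of_commutator`). As `Y` is skew and does not vanish, its image, the
`isoPlane` of `e`, is an isotropic plane, on which the Heisenberg group of `e` acts trivially
(`OrthRep.eichler_zero_apply_of_mem`). The planes of `e` and `f` are in duality
(`OrthRep.eq_zero_of_orthogonal_opposite`), and the pointwise stabilizer of `e` and `f` also acts
trivially on the plane of `e` (`OrthRep.stabilizer_apply_of_mem`).

Let `v` be in the plane of `e`. By these invariances the matrix coefficient `b(v, R(A) v)` depends
only on the number `h(e, A e)`. Evaluating it on Eichler transformations attached to `f` shows
that it equals `c · Re h(e, A e)` with a constant `c > 0` (`OrthRep.exists_coeff_eq`). Thus a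
multiple of `v` has the same matrix coefficient as the vector `e` of the standard representation.
As in the Gelfand–Naimark–Segal construction, `A e ↦ R(A) v` then extends to an equivariant
isometric embedding of `ℂ^(1+q)` (`OrthRep.exists_embedding`). Its image contains a positive
definite plane, so that its orthogonal complement is negative definite. Unipotent isometries of a
definite space are trivial, hence the whole group acts trivially on the complement
(`OrthRep.apply_eq_of_orthogonal`).
-/

/-! ### The Hermitian form and the action of `SU(1, q)` -/

/-- The space `ℂ^(1+q)` of column vectors. -/
abbrev CVec (q : ℕ) : Type := Fin 1 ⊕ Fin q → ℂ

/-- `hermForm 1 q` as a sesquilinear map. -/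
noncomputable def herm (q : ℕ) : CVec q →ₗ⋆[ℂ] CVec q →ₗ[ℂ] ℂ :=
  LinearMap.mk₂'ₛₗ (starRingEnd ℂ) (RingHom.id ℂ) (hermForm 1 q)
    (by intro x y z; simp [hermForm, add_dotProduct])
    (by intro c x y; simp [hermForm, smul_dotProduct])
    (by intro x y z; simp [hermForm, mulVec_add, dotProduct_add])
    (by intro c x y; simp [hermForm, mulVec_smul, dotProduct_smul])

lemma herm_apply (q : ℕ) (x y : CVec q) : herm q x y = hermForm 1 q x y := rfl

lemma herm_eq_sum (q : ℕ) (x y : CVec q) :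
    herm q x y = star (x (Sum.inl 0)) * y (Sum.inl 0)
      - ∑ i, star (x (Sum.inr i)) * y (Sum.inr i) := by
  simp [herm_apply, hermForm, sigMatrix, LieAlgebra.Orthogonal.indefiniteDiagonal,
    mulVec_diagonal, dotProduct, sub_eq_add_neg]

lemma herm_conj (q : ℕ) (x y : CVec q) : (starRingEnd ℂ) (herm q x y) = herm q y x := by
  simp [herm_eq_sum, mul_comm]

lemma herm_self_im (q : ℕ) (x : CVec q) : (herm q x x).im = 0 := by
  have := herm_conj q x x
  exact Complex.conj_eq_iff_im.mp this

lemma herm_self_re (q : ℕ) (x : CVec q) : ((herm q x x).re : ℂ) = herm q x x := by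
  apply Complex.ext <;> simp [herm_self_im]

lemma herm_eq_zero_comm {q : ℕ} {x y : CVec q} (hxy : herm q x y = 0) : herm q y x = 0 := by
  rw [← herm_conj, hxy, map_zero]

/-- A matrix in `SU(1, q)` as an endomorphism of `ℂ^(1+q)`. -/
noncomputable def act (q : ℕ) : SU 1 q →* Module.End ℂ (CVec q) where
  toFun A := Matrix.toLin' A.1.1
  map_one' := by
    change Matrix.toLin' (1 : Matrix _ _ ℂ) = 1
    rw [Matrix.toLin'_one]; rfl
  map_mul' A B := by
    change Matrix.toLin' (A.1.1 * B.1.1) = _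
    rw [Matrix.toLin'_mul]; rfl

lemma act_apply {q : ℕ} (A : SU 1 q) (x : CVec q) : act q A x = A.1.1 *ᵥ x := rfl

lemma act_injective (q : ℕ) : Function.Injective (act q) := by
  intro A B hAB
  apply Subtype.ext
  apply Subtype.ext
  exact Matrix.toLin'.injective hAB

lemma SU_ext {q : ℕ} {A B : SU 1 q} (h : ∀ x, act q A x = act q B x) : A = B :=
  act_injective q (LinearMap.ext h)

lemma act_inv_act {q : ℕ} (A : SU 1 q) (x : CVec q) : act q A⁻¹ (act q A x) = x := by
  rw [← Module.End.mul_apply, ← map_mul]; simp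

lemma act_inv_eq {q : ℕ} {A : SU 1 q} {x y : CVec q} (h : act q A x = y) : act q A⁻¹ y = x := by
  rw [← h, act_inv_act]

lemma act_act_inv {q : ℕ} (A : SU 1 q) (x : CVec q) : act q A (act q A⁻¹ x) = x := by
  rw [← Module.End.mul_apply, ← map_mul]; simp

lemma act_mul_apply {q : ℕ} (A B : SU 1 q) (x : CVec q) :
    act q (A * B) x = act q A (act q B x) := by
  rw [map_mul, Module.End.mul_apply]

lemma herm_act {q : ℕ} (A : SU 1 q) (x y : CVec q) :
    herm q (act q A x) (act q A y) = herm q x y := by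
  have hA : A.1.1ᴴ * sigMatrix ℂ 1 q * A.1.1 = sigMatrix ℂ 1 q := A.2
  simp only [herm_apply, hermForm, act_apply, star_mulVec]
  rw [← dotProduct_mulVec, mulVec_mulVec, mulVec_mulVec, hA]

lemma det_act {q : ℕ} (A : SU 1 q) : LinearMap.det (act q A) = 1 := by
  change LinearMap.det (Matrix.toLin' A.1.1) = 1
  rw [LinearMap.det_toLin']
  exact A.1.2

lemma exists_act_eq {q : ℕ} (T : Module.End ℂ (CVec q))
    (hT : ∀ x y, herm q (T x) (T y) = herm q x y) (hdet : LinearMap.det T = 1) :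
    ∃ A : SU 1 q, act q A = T := by
  refine ⟨⟨⟨LinearMap.toMatrix' T, by rw [LinearMap.det_toMatrix', hdet]⟩, ?_⟩, ?_⟩
  · change (LinearMap.toMatrix' T)ᴴ * sigMatrix ℂ 1 q * LinearMap.toMatrix' T = sigMatrix ℂ 1 q
    apply Matrix.ext
    intro i j
    have key := hT (Pi.single i 1) (Pi.single j 1)
    have hs : ∀ M : Matrix (Fin 1 ⊕ Fin q) (Fin 1 ⊕ Fin q) ℂ,
        star (Pi.single i (1 : ℂ)) ⬝ᵥ (M *ᵥ Pi.single j 1) = M i j := by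
      intro M
      have : star (Pi.single i (1 : ℂ) : CVec q) = Pi.single i 1 := by
        rw [← Pi.single_star, star_one]
      rw [this]; simp
    rw [← hs ((LinearMap.toMatrix' T)ᴴ * sigMatrix ℂ 1 q * LinearMap.toMatrix' T),
      ← hs (sigMatrix ℂ 1 q)]
    simp only [herm_apply, hermForm] at key
    rw [← key, ← LinearMap.toMatrix'_mulVec, ← LinearMap.toMatrix'_mulVec, star_mulVec,
      ← dotProduct_mulVec, mulVec_mulVec, mulVec_mulVec, Matrix.mul_assoc]
  · change Matrix.toLin' (LinearMap.toMatrix' T) = T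
    simp

open Classical in
/-- The element of `SU(1, q)` acting as the endomorphism `T`; the identity if there is none. -/
noncomputable def ofEnd {q : ℕ} (T : Module.End ℂ (CVec q)) : SU 1 q :=
  if h : ∃ A : SU 1 q, act q A = T then h.choose else 1

lemma act_ofEnd {q : ℕ} {T : Module.End ℂ (CVec q)}
    (hT : ∀ x y, herm q (T x) (T y) = herm q x y) (hdet : LinearMap.det T = 1) :
    act q (ofEnd T) = T := by
  have h := exists_act_eq T hT hdet
  rw [ofEnd, dif_pos h]
  exact h.choose_spec

lemma continuous_to_SU {q : ℕ} {X : Type*} [TopologicalSpace X] {g : X → SU 1 q}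
    (hg : ∀ x : CVec q, Continuous fun t => act q (g t) x) : Continuous g := by
  refine continuous_induced_rng.2 (continuous_induced_rng.2 ?_)
  apply continuous_matrix
  intro i j
  have := (continuous_apply i).comp (hg (Pi.single j 1))
  refine this.congr fun t => ?_
  simp only [Function.comp_apply, act_apply, mulVec_single_one, col_apply]
  rfl

/-! ### Eichler transformations and complex reflections -/

/-- The Eichler transformation `x ↦ x + h(e,x) u - h(u,x) e + (i s - h(u,u)/2) h(e,x) e`; it is
unitary if `e` is isotropic and `u` is orthogonal to `e`. It is written as a product of two
transvections. -/
noncomputable def eichlerEnd {q : ℕ} (e u : CVec q) (s : ℝ) : Module.End ℂ (CVec q) :=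
  LinearMap.transvection (herm q u) (-e) *
    LinearMap.transvection (herm q e) (u + (Complex.I * s + herm q u u / 2) • e)

lemma eichlerEnd_apply {q : ℕ} {e u : CVec q} (hu : herm q u e = 0) (s : ℝ)
    (x : CVec q) :
    eichlerEnd e u s x = x + herm q e x • u - herm q u x • e
      + ((Complex.I * s - herm q u u / 2) * herm q e x) • e := by
  simp only [eichlerEnd, Module.End.mul_apply, LinearMap.transvection.apply, map_add, map_smul, hu]
  module

/-- The Eichler transformation as an element of `SU(1, q)`. -/
noncomputable def eichler {q : ℕ} (e u : CVec q) (s : ℝ) : SU 1 q := ofEnd (eichlerEnd e u s)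

lemma act_eichler {q : ℕ} {e u : CVec q} (he : herm q e e = 0) (hu : herm q e u = 0) (s : ℝ)
    (x : CVec q) :
    act q (eichler e u s) x = x + herm q e x • u - herm q u x • e
      + ((Complex.I * s - herm q u u / 2) * herm q e x) • e := by
  have hu' := herm_eq_zero_comm hu
  rw [eichler, act_ofEnd, eichlerEnd_apply hu']
  · intro x y
    rw [eichlerEnd_apply hu', eichlerEnd_apply hu']
    simp only [map_add, map_sub, map_smul, map_smulₛₗ, LinearMap.add_apply, LinearMap.sub_apply,
      LinearMap.smul_apply, smul_eq_mul, hu, hu', he, map_mul, Complex.conj_I, Complex.conj_ofReal,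
      map_div₀, herm_conj, Complex.conj_ofNat]
    ring
  · simp [eichlerEnd, LinearMap.transvection.det, he, hu, hu']

/-- The complex reflection with root `c` and multiplier `β`; it is unitary if `c` is anisotropic
and `β` has absolute value `1`. -/
noncomputable def reflEnd {q : ℕ} (c : CVec q) (β : ℂ) : Module.End ℂ (CVec q) :=
  LinearMap.transvection (herm q c) (((β - 1) / herm q c c) • c)

lemma reflEnd_apply {q : ℕ} (c : CVec q) (β : ℂ) (x : CVec q) :
    reflEnd c β x = x + ((β - 1) / herm q c c * herm q c x) • c := by
  simp only [reflEnd, LinearMap.transvection.apply]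
  module

lemma det_reflEnd {q : ℕ} {c : CVec q} (hc : herm q c c ≠ 0) (β : ℂ) :
    LinearMap.det (reflEnd c β) = β := by
  simp [reflEnd, LinearMap.transvection.det, hc]

lemma herm_reflEnd {q : ℕ} {c : CVec q} (hc : herm q c c ≠ 0) {β : ℂ}
    (hβ : β * (starRingEnd ℂ) β = 1) (x y : CVec q) :
    herm q (reflEnd c β x) (reflEnd c β y) = herm q x y := by
  simp only [reflEnd_apply, map_add, map_smul, map_smulₛₗ, LinearMap.add_apply,
    LinearMap.smul_apply, smul_eq_mul, map_mul, map_div₀, map_sub, map_one, herm_conj]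
  field_simp
  linear_combination (herm q x c * herm q c y) * hβ

/-- The product of the reflection in `c` with multiplier `β` and the reflection in `c'` with
multiplier `β⁻¹`. -/
noncomputable def biRefl {q : ℕ} (c c' : CVec q) (β : ℂ) : SU 1 q :=
  ofEnd (reflEnd c β * reflEnd c' β⁻¹)

lemma act_biRefl {q : ℕ} {c c' : CVec q} (hc : herm q c c ≠ 0) (hc' : herm q c' c' ≠ 0) {β : ℂ}
    (hβ : β * (starRingEnd ℂ) β = 1) (x : CVec q) :
    act q (biRefl c c' β) x = reflEnd c β (reflEnd c' β⁻¹ x) := by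
  have hβ0 : β ≠ 0 := by rintro rfl; simp at hβ
  have hβ' : β⁻¹ * (starRingEnd ℂ) β⁻¹ = 1 := by
    rw [map_inv₀, ← mul_inv, hβ, inv_one]
  rw [biRefl, act_ofEnd, Module.End.mul_apply]
  · intro x y
    rw [Module.End.mul_apply, Module.End.mul_apply, herm_reflEnd hc hβ, herm_reflEnd hc' hβ']
  · rw [map_mul, det_reflEnd hc, det_reflEnd hc', mul_inv_cancel₀ hβ0]

lemma reflEnd_self {q : ℕ} {c : CVec q} (hc : herm q c c ≠ 0) (β : ℂ) :
    reflEnd c β c = β • c := by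
  rw [reflEnd_apply]
  field_simp
  module

lemma reflEnd_of_orth {q : ℕ} {c x : CVec q} (hx : herm q c x = 0) (β : ℂ) :
    reflEnd c β x = x := by
  rw [reflEnd_apply, hx]; simp

lemma reflEnd_smul {q : ℕ} (c : CVec q) {k : ℂ} (hk : k ≠ 0) (β : ℂ) :
    reflEnd (k • c) β = reflEnd c β := by
  refine LinearMap.ext fun x => ?_
  simp only [reflEnd_apply, map_smul, map_smulₛₗ, LinearMap.smul_apply, smul_eq_mul, smul_smul]
  congr 2
  have : (starRingEnd ℂ) k ≠ 0 := by simpa using hk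
  by_cases hc : herm q c c = 0
  · simp [hc]
  · field_simp

/-- The group law of the Heisenberg group fixing `e`. -/
lemma eichler_mul {q : ℕ} {e u u' : CVec q} (he : herm q e e = 0) (hu : herm q e u = 0)
    (hu' : herm q e u' = 0) (s s' : ℝ) :
    eichler e u s * eichler e u' s' = eichler e (u + u') (s + s' - (herm q u u').im) := by
  have h1 := herm_eq_zero_comm hu
  have h1' := herm_eq_zero_comm hu'
  have h2 : (((herm q u u').im : ℝ) : ℂ) * Complex.I * 2 = herm q u u' - herm q u' u := by
    rw [← herm_conj q u u', Complex.sub_conj]; push_cast; ring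
  apply SU_ext
  intro x
  rw [act_mul_apply, act_eichler he hu, act_eichler he hu', act_eichler he (by simp [hu, hu'])]
  simp only [map_add, map_sub, map_smul, LinearMap.add_apply, smul_eq_mul, he, hu', h1,
    Complex.ofReal_sub, Complex.ofReal_add]
  have h3 : herm q u u' = herm q u' u + ((herm q u u').im : ℝ) * Complex.I * 2 := by
    rw [h2]; ring
  generalize (((herm q u u').im : ℝ) : ℂ) = m at h3
  rw [h3]
  module

lemma eichler_zero {q : ℕ} {e : CVec q} (he : herm q e e = 0) : eichler e 0 0 = 1 := by
  apply SU_ext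
  intro x
  rw [act_eichler he (by simp)]
  simp

lemma conj_eichler {q : ℕ} {e u : CVec q} (he : herm q e e = 0) (hu : herm q e u = 0) (s : ℝ)
    (A : SU 1 q) : A * eichler e u s * A⁻¹ = eichler (act q A e) (act q A u) s := by
  rw [mul_inv_eq_iff_eq_mul]
  apply SU_ext
  intro x
  rw [act_mul_apply, act_mul_apply, act_eichler he hu,
    act_eichler (by rw [herm_act, he]) (by rw [herm_act, hu])]
  simp only [herm_act, map_add, map_sub, map_smul]

lemma conj_biRefl {q : ℕ} {c c' : CVec q} (hc : herm q c c ≠ 0) (hc' : herm q c' c' ≠ 0) {β : ℂ}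
    (hβ : β * (starRingEnd ℂ) β = 1) (A : SU 1 q) :
    A * biRefl c c' β * A⁻¹ = biRefl (act q A c) (act q A c') β := by
  rw [mul_inv_eq_iff_eq_mul]
  apply SU_ext
  intro x
  rw [act_mul_apply, act_mul_apply, act_biRefl hc hc' hβ,
    act_biRefl (by rwa [herm_act]) (by rwa [herm_act]) hβ]
  simp only [reflEnd_apply, herm_act, map_add, map_smul]

lemma eichler_smul {q : ℕ} {e u : CVec q} (he : herm q e e = 0) (hu : herm q e u = 0) (s : ℝ)
    (μ : ℂ) : eichler (μ • e) u s = eichler e ((starRingEnd ℂ) μ • u) (Complex.normSq μ * s) := by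
  have h1 := herm_eq_zero_comm hu
  apply SU_ext
  intro x
  rw [act_eichler (by simp [he]) (by simp [hu]), act_eichler he (by simp [hu])]
  simp only [map_smul, map_smulₛₗ, LinearMap.smul_apply, smul_eq_mul, Complex.ofReal_mul,
    ← Complex.mul_conj, Complex.conj_conj]
  module

lemma eichler_inv {q : ℕ} {e u : CVec q} (he : herm q e e = 0) (hu : herm q e u = 0) (s : ℝ) :
    (eichler e u s)⁻¹ = eichler e (-u) (-s) := by
  rw [inv_eq_iff_mul_eq_one, eichler_mul he hu (by simp [hu])]
  simp [herm_self_im, eichler_zero he]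

lemma continuous_eichler {q : ℕ} {e u : CVec q} (he : herm q e e = 0) (hu : herm q e u = 0)
    {X : Type*} [TopologicalSpace X] {r : X → ℂ} {s : X → ℝ} (hr : Continuous r)
    (hs : Continuous s) : Continuous fun t => eichler e (r t • u) (s t) := by
  apply continuous_to_SU
  intro x
  have : (fun t => act q (eichler e (r t • u) (s t)) x) = fun t =>
      x + herm q e x • (r t • u) - (starRingEnd ℂ (r t) * herm q u x) • e
      + ((Complex.I * s t - starRingEnd ℂ (r t) * (r t * herm q u u) / 2) * herm q e x) • e := by
    funext t
    rw [act_eichler he (by simp [hu])]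
    simp only [map_smul, map_smulₛₗ, LinearMap.smul_apply, smul_eq_mul]
    module
  rw [this]
  fun_prop

lemma act_eichler_self {q : ℕ} {e u : CVec q} (he : herm q e e = 0) (hu : herm q e u = 0)
    (s : ℝ) : act q (eichler e u s) e = e := by
  rw [act_eichler he hu]; simp [he, herm_eq_zero_comm hu]

/-! ### Hyperbolic pairs -/

/-- Two isotropic vectors `e`, `f` with `h(e,f) = 1`. The last two fields record that the
orthogonal complement of their span is negative definite and nonzero. -/
structure HypPair {q : ℕ} (e f : CVec q) : Prop where
  ee : herm q e e = 0
  ff : herm q f f = 0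
  ef : herm q e f = 1
  neg : ∀ x, herm q e x = 0 → herm q f x = 0 → x ≠ 0 → (herm q x x).re < 0
  exists_ne : ∃ u, u ≠ 0 ∧ herm q e u = 0 ∧ herm q f u = 0

namespace HypPair

variable {q : ℕ} {e f : CVec q}

lemma fe (P : HypPair e f) : herm q f e = 1 := by
  rw [← herm_conj, P.ef, map_one]

lemma symm (P : HypPair e f) : HypPair f e :=
  ⟨P.ff, P.ee, P.fe, fun x h1 h2 => P.neg x h2 h1,
    let ⟨u, h0, h1, h2⟩ := P.exists_ne; ⟨u, h0, h2, h1⟩⟩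

lemma decomp (P : HypPair e f) (x : CVec q) :
    ∃ y, herm q e y = 0 ∧ herm q f y = 0 ∧ x = herm q f x • e + herm q e x • f + y := by
  refine ⟨x - herm q f x • e - herm q e x • f, ?_, ?_, by module⟩ <;>
    simp [P.ee, P.ff, P.ef, P.fe]

lemma herm_self_ne (P : HypPair e f) {x : CVec q} (h1 : herm q e x = 0) (h2 : herm q f x = 0)
    (hx : x ≠ 0) : herm q x x ≠ 0 := by
  intro h
  have := P.neg x h1 h2 hx
  simp [h] at this

/-- Every nonzero vector orthogonal to `e` and `f` has a real multiple of square `-2`. -/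
lemma exists_smul (P : HypPair e f) {x : CVec q} (h1 : herm q e x = 0) (h2 : herm q f x = 0)
    (hx : x ≠ 0) : ∃ k : ℝ, k ≠ 0 ∧ herm q ((k : ℂ) • x) ((k : ℂ) • x) = -2 := by
  have hneg := P.neg x h1 h2 hx
  have hpos : 0 < -2 / (herm q x x).re := div_pos_of_neg_of_neg (by norm_num) hneg
  refine ⟨Real.sqrt (-2 / (herm q x x).re), (Real.sqrt_pos.2 hpos).ne', ?_⟩
  have : ((Real.sqrt (-2 / (herm q x x).re) : ℝ) : ℂ) * Real.sqrt (-2 / (herm q x x).re)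
      = ((-2 / (herm q x x).re : ℝ) : ℂ) := by
    rw [← Complex.ofReal_mul, Real.mul_self_sqrt hpos.le]
  simp only [map_smul, map_smulₛₗ, LinearMap.smul_apply, smul_eq_mul, Complex.conj_ofReal]
  have h3 : herm q x x = ((herm q x x).re : ℝ) := (herm_self_re q x).symm
  rw [← mul_assoc, this]
  generalize (herm q x x).re = t at *
  rw [h3, ← Complex.ofReal_mul, div_mul_cancel₀ _ hneg.ne]
  simp

lemma exists_norm (P : HypPair e f) :
    ∃ u, herm q e u = 0 ∧ herm q f u = 0 ∧ herm q u u = -2 := by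
  obtain ⟨u, h0, h1, h2⟩ := P.exists_ne
  obtain ⟨k, _, hk⟩ := P.exists_smul h1 h2 h0
  exact ⟨(k : ℂ) • u, by simp [h1], by simp [h2], hk⟩

/-- An isotropic vector orthogonal to `e` is a multiple of `e`. -/
lemma eq_smul_of_isotropic (P : HypPair e f) {x : CVec q} (hx : herm q x x = 0)
    (hex : herm q e x = 0) : x = herm q f x • e := by
  obtain ⟨y, hy1, hy2, hy⟩ := P.decomp x
  rw [hex, zero_smul, add_zero] at hy
  by_cases h0 : y = 0
  · rw [h0, add_zero] at hy; exact hy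
  · exfalso
    apply P.herm_self_ne hy1 hy2 h0
    have hye := herm_eq_zero_comm hy1
    rw [hy] at hx
    simpa [P.ee, hy1, hye] using hx

/-- Eichler transformations with vector `u ⟂ e` reduce to those with `u ⟂ e, f`. -/
lemma eichler_eq (P : HypPair e f) {u : CVec q} (hu : herm q e u = 0) (s : ℝ) :
    ∃ u' s', herm q e u' = 0 ∧ herm q f u' = 0 ∧
      eichler e u s = eichler e u' 0 * eichler e 0 s' := by
  obtain ⟨y, hy1, hy2, hy⟩ := P.decomp u
  rw [hu, zero_smul, add_zero] at hy
  refine ⟨y, s + 2 * (herm q f u).im, hy1, hy2, ?_⟩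
  have hye := herm_eq_zero_comm hy1
  rw [eichler_mul P.ee hy1 (by simp)]
  apply SU_ext
  intro x
  rw [act_eichler P.ee hu, act_eichler P.ee (by simp [hy1])]
  generalize herm q f u = c at *
  have hc : (2 * (c.im : ℂ)) * Complex.I = c - (starRingEnd ℂ) c := by
    rw [Complex.sub_conj]; push_cast; ring
  rw [hy]
  simp only [map_add, map_smul, map_smulₛₗ, LinearMap.add_apply, LinearMap.smul_apply, smul_eq_mul,
    P.ee, hy1, hye, map_zero, Complex.zero_im, Complex.ofReal_add, Complex.ofReal_mul,
    Complex.ofReal_ofNat, add_zero, zero_add, sub_zero]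
  have hc' : (starRingEnd ℂ) c = c - (2 * (c.im : ℂ)) * Complex.I := by rw [hc]; ring
  rw [hc']
  module

lemma eichler_comm {u u' : CVec q} (he : herm q e e = 0) (hu : herm q e u = 0)
    (hu' : herm q e u' = 0) :
    eichler e u 0 * eichler e u' 0 =
      eichler e 0 (-2 * (herm q u u').im) * (eichler e u' 0 * eichler e u 0) := by
  rw [eichler_mul he hu hu', eichler_mul he hu' hu, eichler_mul he (by simp) (by simp [hu, hu'])]
  have : (herm q u' u).im = -(herm q u u').im := by
    rw [← herm_conj, Complex.conj_im]
  rw [this, add_comm u' u]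
  simp only [map_zero, LinearMap.zero_apply, Complex.zero_im, zero_add, zero_sub, sub_zero]
  congr 1
  ring

/-- The centre of the Heisenberg group consists of commutators. -/
lemma exists_comm (P : HypPair e f) (s : ℝ) :
    ∃ u u', herm q e u = 0 ∧ herm q f u = 0 ∧ herm q e u' = 0 ∧ herm q f u' = 0 ∧
      eichler e u 0 * eichler e u' 0 = eichler e 0 s * (eichler e u' 0 * eichler e u 0) := by
  obtain ⟨u, h1, h2, h3⟩ := P.exists_norm
  refine ⟨u, (Complex.I * (s / 4 : ℝ)) • u, h1, h2, by simp [h1], by simp [h2], ?_⟩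
  rw [eichler_comm P.ee h1 (by simp [h1])]
  congr 2
  simp only [map_smul, h3, smul_eq_mul]
  simp
  ring

/-- The unipotent radical fixing `e` acts transitively on the isotropic vectors with a given
nonzero product with `e`. -/
lemma exists_eichler_act_eq {x y : CVec q} (he : herm q e e = 0) (hx : herm q x x = 0)
    (hy : herm q y y = 0) (hxy : herm q e x = herm q e y) (h0 : herm q e y ≠ 0) :
    ∃ u s, herm q e u = 0 ∧ act q (eichler e u s) x = y := by
  set z := herm q e y with hz
  have hu : herm q e (z⁻¹ • (y - x)) = 0 := by simp [hxy, ← hz]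
  refine ⟨z⁻¹ • (y - x), (herm q y x).im / Complex.normSq z, hu, ?_⟩
  rw [act_eichler he hu, hxy]
  have hcz : (starRingEnd ℂ) z ≠ 0 := by simpa using h0
  have hnz : (Complex.normSq z : ℂ) = z * (starRingEnd ℂ) z := (Complex.mul_conj z).symm
  have him : (((herm q y x).im : ℝ) : ℂ) * Complex.I * 2 = herm q y x - herm q x y := by
    rw [← herm_conj q y x, Complex.sub_conj]; push_cast; ring
  simp only [map_smul, map_smulₛₗ, map_sub, LinearMap.smul_apply, LinearMap.sub_apply, smul_eq_mul,
    hx, hy, Complex.ofReal_div, hnz, map_inv₀]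
  rw [smul_smul, mul_inv_cancel₀ h0]
  have key : (Complex.I * ((herm q y x).im / (z * (starRingEnd ℂ) z)) -
      z⁻¹ * (((starRingEnd ℂ) z)⁻¹ * (0 - herm q x y) - ((starRingEnd ℂ) z)⁻¹ *
        (herm q y x - 0)) / 2) * z = ((starRingEnd ℂ) z)⁻¹ * (herm q y x - 0) := by
    field_simp
    linear_combination him
  rw [key]
  module

/-- The double cosets of the stabilizer of `e` with `h(e, A e) ≠ 0` are determined by the value
`h(e, A e)`. -/
lemma exists_factorization (P : HypPair e f) {A B : SU 1 q}
    (hAB : herm q e (act q A e) = herm q e (act q B e)) (h0 : herm q e (act q B e) ≠ 0) :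
    ∃ u s u' s' σ, herm q e u = 0 ∧ herm q e u' = 0 ∧ act q σ e = e ∧ act q σ f = f ∧
      A = eichler e u s * B * eichler e u' s' * σ := by
  obtain ⟨u, s, hu, h1⟩ := exists_eichler_act_eq P.ee (y := act q A e) (x := act q B e)
    (by rw [herm_act, P.ee]) (by rw [herm_act, P.ee]) hAB.symm (by rwa [hAB])
  have h2 : act q (B⁻¹ * (eichler e u s)⁻¹ * A) e = e := by
    rw [act_mul_apply, act_mul_apply, ← h1, act_inv_act, act_inv_act]
  set p := B⁻¹ * (eichler e u s)⁻¹ * A with hp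
  have hpf : herm q e (act q p f) = 1 := by
    conv_lhs => rw [← h2]
    rw [herm_act, P.ef]
  obtain ⟨u', s', hu', h3⟩ := exists_eichler_act_eq P.ee (x := f) (y := act q p f) P.ff
    (by rw [herm_act, P.ff]) (by rw [hpf, P.ef]) (by simp [hpf])
  refine ⟨u, s, u', s', (eichler e u' s')⁻¹ * p, hu, hu', ?_, ?_, ?_⟩
  · rw [act_mul_apply, h2]
    exact act_inv_eq (act_eichler_self P.ee hu' s')
  · rw [act_mul_apply, ← h3, act_inv_act]
  · rw [hp]; group

end HypPair

/-! ### The algebra of complex reflections -/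

lemma reflEnd_reflEnd {q : ℕ} {c : CVec q} (hc : herm q c c ≠ 0) (β β' : ℂ) (x : CVec q) :
    reflEnd c β (reflEnd c β' x) = reflEnd c (β * β') x := by
  simp only [reflEnd_apply, map_add, map_smul, div_mul_eq_mul_div,
    mul_div_assoc, div_self hc]
  field_simp
  module

lemma reflEnd_one {q : ℕ} (c : CVec q) (x : CVec q) : reflEnd c 1 x = x := by
  simp [reflEnd_apply]

lemma reflEnd_comm {q : ℕ} {c c' : CVec q} (h : herm q c c' = 0) (β β' : ℂ) (x : CVec q) :
    reflEnd c β (reflEnd c' β' x) = reflEnd c' β' (reflEnd c β x) := by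
  simp only [reflEnd_apply, map_add, map_smul, h, herm_eq_zero_comm h]
  module

lemma biRefl_inv {q : ℕ} {c c' : CVec q} (hc : herm q c c ≠ 0) (hc' : herm q c' c' ≠ 0) {β : ℂ}
    (hβ : β * (starRingEnd ℂ) β = 1) : (biRefl c c' β)⁻¹ = biRefl c' c β := by
  have hβ0 : β ≠ 0 := by rintro rfl; simp at hβ
  rw [inv_eq_iff_mul_eq_one]
  apply SU_ext
  intro x
  rw [act_mul_apply, act_biRefl hc hc' hβ, act_biRefl hc' hc hβ, reflEnd_reflEnd hc',
    inv_mul_cancel₀ hβ0, reflEnd_one, reflEnd_reflEnd hc, mul_inv_cancel₀ hβ0, reflEnd_one]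
  simp

lemma biRefl_mul_self {q : ℕ} {c c' : CVec q} (hc : herm q c c ≠ 0) (hc' : herm q c' c' ≠ 0)
    (h : herm q c c' = 0) {β : ℂ} (hβ : β * (starRingEnd ℂ) β = 1) :
    biRefl c c' β * biRefl c c' β = biRefl c c' (β * β) := by
  apply SU_ext
  intro x
  rw [act_mul_apply, act_biRefl hc hc' hβ, act_biRefl hc hc' hβ, act_biRefl hc hc'
    (by rw [map_mul]; linear_combination (β * (starRingEnd ℂ) β + 1) * hβ),
    reflEnd_comm h, reflEnd_reflEnd hc, ← reflEnd_comm h, reflEnd_reflEnd hc', mul_inv]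

lemma act_biRefl_of_orth {q : ℕ} {c c' x : CVec q} (hc : herm q c c ≠ 0) (hc' : herm q c' c' ≠ 0)
    {β : ℂ} (hβ : β * (starRingEnd ℂ) β = 1) (h : herm q c x = 0) (h' : herm q c' x = 0) :
    act q (biRefl c c' β) x = x := by
  rw [act_biRefl hc hc' hβ, reflEnd_of_orth h', reflEnd_of_orth h]

lemma biRefl_smul {q : ℕ} {c c' : CVec q} {k k' : ℂ} (hk : k ≠ 0) (hk' : k' ≠ 0) (β : ℂ) :
    biRefl (k • c) (k' • c') β = biRefl c c' β := by
  rw [biRefl, reflEnd_smul c hk, reflEnd_smul c' hk', biRefl]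

/-- The quarter turn `u₁ ↦ u₂ ↦ -u₁` in the plane of two orthogonal vectors of equal square. -/
noncomputable def quarterTurn {q : ℕ} (u₁ u₂ : CVec q) : SU 1 q := biRefl u₁ (u₁ - u₂) (-1)

section quarterTurn

variable {q : ℕ} {u₁ u₂ : CVec q} (h0 : herm q u₁ u₁ ≠ 0) (h1 : herm q u₁ u₁ = herm q u₂ u₂)
  (h2 : herm q u₁ u₂ = 0)

include h1 h2 in
lemma herm_sub_self : herm q (u₁ - u₂) (u₁ - u₂) = 2 * herm q u₁ u₁ := by
  simp [h2, herm_eq_zero_comm h2, ← h1]; ring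

include h0 h1 h2

lemma herm_sub_self_ne : herm q (u₁ - u₂) (u₁ - u₂) ≠ 0 := by
  rw [herm_sub_self h1 h2]; simpa using h0

lemma act_quarterTurn_left : act q (quarterTurn u₁ u₂) u₁ = u₂ := by
  rw [quarterTurn, act_biRefl h0 (herm_sub_self_ne h0 h1 h2) (by simp)]
  rw [reflEnd_apply (u₁ - u₂), herm_sub_self h1 h2]
  have : ((-1 : ℂ)⁻¹ - 1) / (2 * herm q u₁ u₁) * herm q (u₁ - u₂) u₁ = -1 := by
    simp [herm_eq_zero_comm h2]; field_simp; ring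
  rw [this, show u₁ + (-1 : ℂ) • (u₁ - u₂) = u₂ by module, reflEnd_of_orth h2]

lemma act_quarterTurn_right : act q (quarterTurn u₁ u₂) u₂ = -u₁ := by
  rw [quarterTurn, act_biRefl h0 (herm_sub_self_ne h0 h1 h2) (by simp)]
  rw [reflEnd_apply (u₁ - u₂), herm_sub_self h1 h2]
  have : ((-1 : ℂ)⁻¹ - 1) / (2 * herm q u₁ u₁) * herm q (u₁ - u₂) u₂ = 1 := by
    simp [h2, ← h1]; field_simp; ring
  rw [this, show u₂ + (1 : ℂ) • (u₁ - u₂) = u₁ by module, reflEnd_self h0]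
  simp

lemma act_quarterTurn_of_orth {x : CVec q} (hx1 : herm q u₁ x = 0) (hx2 : herm q u₂ x = 0) :
    act q (quarterTurn u₁ u₂) x = x :=
  act_biRefl_of_orth h0 (herm_sub_self_ne h0 h1 h2) (by simp) hx1 (by simp [hx1, hx2])

lemma quarterTurn_pow_four : quarterTurn u₁ u₂ ^ 4 = 1 := by
  have ha := act_quarterTurn_left h0 h1 h2
  have hb := act_quarterTurn_right h0 h1 h2
  have hc : herm q u₂ u₂ ≠ 0 := by rwa [← h1]
  apply SU_ext
  intro x
  have hx : x = (herm q u₁ x / herm q u₁ u₁) • u₁ + (herm q u₂ x / herm q u₂ u₂) • u₂ +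
    (x - (herm q u₁ x / herm q u₁ u₁) • u₁ - (herm q u₂ x / herm q u₂ u₂) • u₂) := by module
  have h3 : act q (quarterTurn u₁ u₂)
      (x - (herm q u₁ x / herm q u₁ u₁) • u₁ - (herm q u₂ x / herm q u₂ u₂) • u₂) =
      (x - (herm q u₁ x / herm q u₁ u₁) • u₁ - (herm q u₂ x / herm q u₂ u₂) • u₂) := by
    apply act_quarterTurn_of_orth h0 h1 h2
    · simp [h2, h0]
    · simp [herm_eq_zero_comm h2, hc]
  generalize x - (herm q u₁ x / herm q u₁ u₁) • u₁ - (herm q u₂ x / herm q u₂ u₂) • u₂ = y at *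
  rw [hx]
  simp only [pow_succ, pow_zero, one_mul, act_mul_apply, map_add, map_smul, ha, hb, h3, map_neg,
    map_one, Module.End.one_apply, neg_neg]

/-- Quarter turns exchange the two roots of a double reflection, so every double reflection is a
commutator with a quarter turn: `t * t` runs through all numbers of absolute value `1`. -/
lemma comm_quarterTurn {t : ℂ} (ht : t * (starRingEnd ℂ) t = 1) :
    biRefl u₁ u₂ t * quarterTurn u₁ u₂ * (biRefl u₁ u₂ t)⁻¹ * (quarterTurn u₁ u₂)⁻¹ =
      biRefl u₁ u₂ (t * t) := by
  have hc : herm q u₂ u₂ ≠ 0 := by rwa [← h1]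
  rw [biRefl_inv h0 hc ht, mul_assoc, mul_assoc, ← mul_assoc (quarterTurn u₁ u₂),
    conj_biRefl hc h0 ht, act_quarterTurn_left h0 h1 h2, act_quarterTurn_right h0 h1 h2]
  have : biRefl (-u₁) u₂ t = biRefl u₁ u₂ t := by
    have := biRefl_smul (c := u₁) (c' := u₂) (k := -1) (k' := 1) (by simp) (by simp) t
    simpa using this
  rw [this, biRefl_mul_self h0 hc h2 ht]

end quarterTurn

lemma exists_unit_sqrt {t : ℂ} (ht : t * (starRingEnd ℂ) t = 1) :
    ∃ s : ℂ, s * (starRingEnd ℂ) s = 1 ∧ s * s = t := by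
  obtain ⟨s, hs⟩ := IsAlgClosed.exists_pow_nat_eq t (n := 2) (by norm_num)
  refine ⟨s, ?_, by rw [← hs, sq]⟩
  rw [Complex.mul_conj] at ht ⊢
  have h : Complex.normSq s ^ 2 = 1 := by
    rw [← map_pow, hs]; exact_mod_cast ht
  have h' : Complex.normSq s = 1 := by
    have := Complex.normSq_nonneg s
    nlinarith
  exact_mod_cast h'

/-- A special unitary transformation supported on a negative definite subspace `Q` is a product of
the elements `biRefl u₁ u₂ t` with `u₁, u₂ ∈ Q` orthogonal: such an element moves the eigenvalue
of one eigenvector to the orthogonal complement. -/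
lemma mem_of_biRefl_mem {q : ℕ} (K : Subgroup (SU 1 q)) (k : ℕ) :
    ∀ Q : Submodule ℂ (CVec q), Module.finrank ℂ Q = k →
      (∀ x ∈ Q, x ≠ 0 → (herm q x x).re < 0) →
      (∀ u₁ ∈ Q, ∀ u₂ ∈ Q, u₁ ≠ 0 → u₂ ≠ 0 → herm q u₁ u₂ = 0 → ∀ t : ℂ,
        t * (starRingEnd ℂ) t = 1 → biRefl u₁ u₂ t ∈ K) →
      ∀ σ : SU 1 q, (∀ x, (∀ y ∈ Q, herm q y x = 0) → act q σ x = x) →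
        (∀ y ∈ Q, act q σ y ∈ Q) → σ ∈ K := by
  induction k using Nat.strong_induction_on with
  | _ k ih =>
  intro Q hk hneg hK σ hfix hinv
  have hne : ∀ x ∈ Q, x ≠ 0 → herm q x x ≠ 0 := by
    intro x hx hx0 h
    have := hneg x hx hx0
    simp [h] at this
  by_cases hQ : Q = ⊥
  · have : σ = 1 := by
      apply SU_ext
      intro x
      rw [hfix x (by simp [hQ])]; simp
    rw [this]; exact K.one_mem
  have hnt : Nontrivial Q := Submodule.nontrivial_iff_ne_bot.2 hQ
  obtain ⟨t, ht⟩ := Module.End.exists_eigenvalue ((act q σ).restrict hinv)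
  obtain ⟨v, hv⟩ := ht.exists_hasEigenvector
  have hv1 : act q σ v.1 = t • v.1 := congrArg Subtype.val hv.apply_eq_smul
  obtain ⟨u₁, hu₁⟩ := v
  have hu0 : u₁ ≠ 0 := fun h => hv.2 (Subtype.ext h)
  simp only at hv1
  have hN := hne u₁ hu₁ hu0
  have ht1 : t * (starRingEnd ℂ) t = 1 := by
    have := herm_act σ u₁ u₁
    rw [hv1] at this
    simp only [map_smul, map_smulₛₗ, LinearMap.smul_apply, smul_eq_mul] at this
    have h2 : (t * (starRingEnd ℂ) t - 1) * herm q u₁ u₁ = 0 := by linear_combination this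
    rcases mul_eq_zero.1 h2 with h | h
    · linear_combination h
    · exact absurd h hN
  have ht0 : t ≠ 0 := by rintro rfl; simp at ht1
  by_cases hex : ∃ u₂ ∈ Q, u₂ ≠ 0 ∧ herm q u₁ u₂ = 0
  · obtain ⟨u₂, hu₂, hu₂0, horth⟩ := hex
    have hN2 := hne u₂ hu₂ hu₂0
    have hdK : biRefl u₁ u₂ t ∈ K := hK u₁ hu₁ u₂ hu₂ hu0 hu₂0 horth t ht1
    -- after multiplication by a double reflection, `u₁` is fixed as well
    set τ := (biRefl u₁ u₂ t)⁻¹ * σ with hτ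
    suffices τ ∈ K by
      have h := K.mul_mem hdK this
      rwa [hτ, mul_inv_cancel_left] at h
    have hd1 : act q (biRefl u₁ u₂ t) u₁ = t • u₁ := by
      rw [act_biRefl hN hN2 ht1, reflEnd_of_orth (herm_eq_zero_comm horth), reflEnd_self hN]
    have hτ1 : act q τ u₁ = u₁ := by
      rw [hτ, act_mul_apply, hv1]
      exact act_inv_eq hd1
    have hdQ : ∀ y ∈ Q, act q (biRefl u₁ u₂ t)⁻¹ y ∈ Q := by
      intro y hy
      rw [biRefl_inv hN hN2 ht1, act_biRefl hN2 hN ht1]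
      simp only [reflEnd_apply]
      exact Q.add_mem (Q.add_mem hy (Q.smul_mem _ hu₁)) (Q.smul_mem _ hu₂)
    set Q' : Submodule ℂ (CVec q) := Q ⊓ LinearMap.ker (herm q u₁) with hQ'
    have hlt : Q' < Q := by
      refine lt_of_le_of_ne inf_le_left ?_
      intro h
      have : u₁ ∈ Q' := by rw [h]; exact hu₁
      exact hN (LinearMap.mem_ker.1 this.2)
    refine ih _ (hk ▸ Submodule.finrank_lt_finrank_of_lt hlt) Q' rfl
      (fun x hx => hneg x hx.1)
      (fun x hx y hy => hK x hx.1 y hy.1) τ ?_ ?_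
    · intro x hx
      set x' := x - (herm q u₁ x / herm q u₁ u₁) • u₁ with hx'
      have hx1 : herm q u₁ x' = 0 := by simp [hx', hN]
      have hxQ : ∀ y ∈ Q, herm q y x' = 0 := by
        intro y hy
        set y' := y - (herm q u₁ y / herm q u₁ u₁) • u₁ with hy'
        have hy1 : herm q u₁ y' = 0 := by simp [hy', hN]
        have hyQ : y' ∈ Q' := ⟨Q.sub_mem hy (Q.smul_mem _ hu₁), LinearMap.mem_ker.2 hy1⟩
        have hyx : herm q y' x' = 0 := by
          rw [hx', map_sub, map_smul, hx y' hyQ, herm_eq_zero_comm hy1]; simp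
        have : y = y' + (herm q u₁ y / herm q u₁ u₁) • u₁ := by rw [hy']; module
        rw [this, map_add, map_smulₛₗ, LinearMap.add_apply, LinearMap.smul_apply, hyx, hx1]
        simp
      have hτx' : act q τ x' = x' := by
        rw [hτ, act_mul_apply, hfix x' hxQ, biRefl_inv hN hN2 ht1]
        exact act_biRefl_of_orth hN2 hN ht1 (hxQ _ hu₂) hx1
      have : x = x' + (herm q u₁ x / herm q u₁ u₁) • u₁ := by rw [hx']; module
      rw [this, map_add, map_smul, hτx', hτ1]
    · intro y hy
      refine ⟨?_, LinearMap.mem_ker.2 ?_⟩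
      · rw [hτ, act_mul_apply]
        exact hdQ _ (hinv y hy.1)
      · conv_lhs => rw [← hτ1]
        rw [herm_act]
        exact LinearMap.mem_ker.1 hy.2
  · push Not at hex
    -- here `Q` is a line, and the determinant forces the eigenvalue to be `1`
    have hσ : act q σ = reflEnd u₁ t := by
      refine LinearMap.ext fun x => ?_
      set x' := x - (herm q u₁ x / herm q u₁ u₁) • u₁ with hx'
      have hx1 : herm q u₁ x' = 0 := by simp [hx', hN]
      have hxQ : ∀ y ∈ Q, herm q y x' = 0 := by
        intro y hy
        set y' := y - (herm q u₁ y / herm q u₁ u₁) • u₁ with hy'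
        have hy1 : herm q u₁ y' = 0 := by simp [hy', hN]
        have hy0 : y' = 0 := by
          by_contra h
          exact hex y' (Q.sub_mem hy (Q.smul_mem _ hu₁)) h hy1
        have : y = (herm q u₁ y / herm q u₁ u₁) • u₁ := by
          rw [hy'] at hy0; exact sub_eq_zero.1 hy0
        rw [this, map_smulₛₗ, LinearMap.smul_apply, hx1]
        simp
      have : x = x' + (herm q u₁ x / herm q u₁ u₁) • u₁ := by rw [hx']; module
      rw [this, map_add, map_smul, map_add, map_smul, hfix x' hxQ, hv1, reflEnd_of_orth hx1,
        reflEnd_self hN]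
    have ht' : t = 1 := by
      rw [← det_reflEnd hN t, ← hσ, det_act]
    have : σ = 1 := by
      apply SU_ext
      intro x
      rw [hσ, ht', reflEnd_one]; simp
    rw [this]; exact K.one_mem

/-! ### Generation of `SU(1, q)` by Eichler transformations -/

namespace HypPair

variable {q : ℕ} {e f : CVec q}

/-- The pointwise stabilizer of a hyperbolic pair is contained in every subgroup which it
normalizes and which contains the quarter turns. -/
lemma stabilizer_le (P : HypPair e f) (K : Subgroup (SU 1 q))
    (hnorm : ∀ σ, act q σ e = e → act q σ f = f → ∀ A ∈ K, σ * A * σ⁻¹ ∈ K)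
    (hK : ∀ u₁ u₂, herm q e u₁ = 0 → herm q f u₁ = 0 → herm q e u₂ = 0 → herm q f u₂ = 0 →
      herm q u₁ u₁ = -2 → herm q u₂ u₂ = -2 → herm q u₁ u₂ = 0 → quarterTurn u₁ u₂ ∈ K)
    {σ : SU 1 q} (hσe : act q σ e = e) (hσf : act q σ f = f) : σ ∈ K := by
  set Q : Submodule ℂ (CVec q) := LinearMap.ker (herm q e) ⊓ LinearMap.ker (herm q f) with hQ
  have hmem : ∀ x, x ∈ Q ↔ herm q e x = 0 ∧ herm q f x = 0 := by
    intro x; simp [hQ]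
  refine mem_of_biRefl_mem K _ Q rfl (fun x hx => P.neg x ((hmem x).1 hx).1 ((hmem x).1 hx).2)
    ?_ σ ?_ ?_
  · intro u₁ hu₁ u₂ hu₂ h1 h2 h12 t ht
    rw [hmem] at hu₁ hu₂
    obtain ⟨k₁, hk₁, hn₁⟩ := P.exists_smul hu₁.1 hu₁.2 h1
    obtain ⟨k₂, hk₂, hn₂⟩ := P.exists_smul hu₂.1 hu₂.2 h2
    rw [← biRefl_smul (k := k₁) (k' := k₂) (by simpa using hk₁) (by simpa using hk₂)]
    set v₁ := (k₁ : ℂ) • u₁ with hv₁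
    set v₂ := (k₂ : ℂ) • u₂ with hv₂
    have he1 : herm q e v₁ = 0 := by simp [hv₁, hu₁]
    have hf1 : herm q f v₁ = 0 := by simp [hv₁, hu₁]
    have he2 : herm q e v₂ = 0 := by simp [hv₂, hu₂]
    have hf2 : herm q f v₂ = 0 := by simp [hv₂, hu₂]
    have h12' : herm q v₁ v₂ = 0 := by
      rw [hv₁, hv₂, map_smul, map_smulₛₗ, LinearMap.smul_apply, h12]; simp
    have hj := hK v₁ v₂ he1 hf1 he2 hf2 hn₁ hn₂ h12'
    obtain ⟨s, hs, hst⟩ := exists_unit_sqrt ht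
    have hne1 : herm q v₁ v₁ ≠ 0 := by simp [hn₁]
    have hne2 : herm q v₂ v₂ ≠ 0 := by simp [hn₂]
    rw [← hst, ← comm_quarterTurn hne1 (by rw [hn₁, hn₂]) h12' hs]
    refine K.mul_mem (hnorm _ ?_ ?_ _ hj) (K.inv_mem hj)
    · exact act_biRefl_of_orth hne1 hne2 hs (herm_eq_zero_comm he1) (herm_eq_zero_comm he2)
    · exact act_biRefl_of_orth hne1 hne2 hs (herm_eq_zero_comm hf1) (herm_eq_zero_comm hf2)
  · intro x hx
    obtain ⟨y, hy1, hy2, hy⟩ := P.decomp x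
    have hy0 : y = 0 := by
      by_contra h
      apply P.herm_self_ne hy1 hy2 h
      have := hx y ((hmem y).2 ⟨hy1, hy2⟩)
      rw [hy] at this
      simpa [herm_eq_zero_comm hy1, herm_eq_zero_comm hy2] using this
    rw [hy, hy0]
    simp [hσe, hσf]
  · intro y hy
    rw [hmem] at hy ⊢
    constructor
    · rw [← hy.1]; conv_lhs => rw [← hσe]
      rw [herm_act]
    · rw [← hy.2]; conv_lhs => rw [← hσf]
      rw [herm_act]

/-- An element exchanging `e` and `f` up to a scalar, in the group generated by the two root
groups of central elements. -/
noncomputable def weyl (e f : CVec q) : SU 1 q := eichler e 0 1 * eichler f 0 1 * eichler e 0 1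

lemma act_weyl (P : HypPair e f) (x : CVec q) : act q (weyl e f) x =
    x + (Complex.I * herm q e x - herm q f x) • e + (Complex.I * herm q f x - herm q e x) • f := by
  rw [weyl, act_mul_apply, act_mul_apply, act_eichler P.ee (by simp), act_eichler P.ff (by simp),
    act_eichler P.ee (by simp)]
  simp only [map_add, map_smul, map_zero, LinearMap.zero_apply, P.ee, P.ef, P.fe,
    smul_eq_mul, smul_zero, zero_smul, Complex.ofReal_one, zero_div, sub_zero, add_zero, mul_one,
    mul_zero]
  have hI : Complex.I * Complex.I = -1 := Complex.I_mul_I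
  match_scalars
  · ring
  · linear_combination (herm q f x + Complex.I * herm q e x) * hI
  · linear_combination (herm q e x) * hI

lemma act_weyl_left (P : HypPair e f) : act q (weyl e f) e = Complex.I • f := by
  rw [P.act_weyl]; simp [P.ee, P.fe]

lemma act_weyl_right (P : HypPair e f) : act q (weyl e f) f = Complex.I • e := by
  rw [P.act_weyl]; simp [P.ff, P.ef]

lemma act_weyl_of_orth (P : HypPair e f) {x : CVec q} (h1 : herm q e x = 0)
    (h2 : herm q f x = 0) : act q (weyl e f) x = x := by
  rw [P.act_weyl]; simp [h1, h2]

/-- The element acting by `-1` on the span of `e` and `f` and trivially on its orthogonal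
complement. -/
noncomputable def centralInv (e f : CVec q) : SU 1 q := weyl e f * weyl e f

lemma act_centralInv_left (P : HypPair e f) : act q (centralInv e f) e = -e := by
  rw [centralInv, act_mul_apply, P.act_weyl_left, map_smul, P.act_weyl_right, smul_smul]
  simp

lemma act_centralInv_right (P : HypPair e f) : act q (centralInv e f) f = -f := by
  rw [centralInv, act_mul_apply, P.act_weyl_right, map_smul, P.act_weyl_left, smul_smul]
  simp

lemma act_centralInv_of_orth (P : HypPair e f) {x : CVec q} (h1 : herm q e x = 0)
    (h2 : herm q f x = 0) : act q (centralInv e f) x = x := by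
  rw [centralInv, act_mul_apply, P.act_weyl_of_orth h1 h2, P.act_weyl_of_orth h1 h2]

lemma herm_sub (P : HypPair e f) : herm q (e - f) (e - f) = -2 := by
  simp [P.ee, P.ff, P.ef, P.fe]; norm_num

lemma herm_add (P : HypPair e f) : herm q (e + f) (e + f) = 2 := by
  simp [P.ee, P.ff, P.ef, P.fe]; norm_num

/-- A double reflection as a word in opposite Eichler transformations, analogous to the
factorization of a Weyl group element of `SL(2)`. -/
lemma eichler_weyl (P : HypPair e f) {u : CVec q} (h1 : herm q e u = 0) (h2 : herm q f u = 0)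
    (h3 : herm q u u = -2) :
    eichler e u 0 * eichler f (-u) 0 * eichler e u 0 = biRefl (e - f) u (-1) := by
  apply SU_ext
  intro x
  rw [act_biRefl (by rw [P.herm_sub]; norm_num) (by rw [h3]; norm_num) (by simp),
    act_mul_apply, act_mul_apply, act_eichler P.ee h1, act_eichler P.ff (by simp [h2]),
    act_eichler P.ee h1, reflEnd_apply, reflEnd_apply, P.herm_sub, h3]
  simp only [map_add, map_sub, map_smul, map_neg, LinearMap.neg_apply, LinearMap.sub_apply,
    P.ee, P.ef, P.fe, h1, h2, h3, herm_eq_zero_comm h1, herm_eq_zero_comm h2, smul_eq_mul]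
  norm_num
  module

/-- A quarter turn is a product of two double reflections sharing the root `e - f`. -/
lemma quarterTurn_eq (P : HypPair e f) {u₁ u₂ : CVec q} (h1 : herm q e u₁ = 0)
    (h1' : herm q f u₁ = 0) (h2 : herm q e u₂ = 0) (h2' : herm q f u₂ = 0)
    (hn1 : herm q u₁ u₁ = -2) (hn2 : herm q u₂ u₂ = -2) (h12 : herm q u₁ u₂ = 0) :
    ∃ v, herm q e v = 0 ∧ herm q f v = 0 ∧ herm q v v = -2 ∧
      quarterTurn u₁ u₂ = biRefl (e - f) u₁ (-1) * biRefl (e - f) v (-1) := by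
  have hs : herm q (u₁ - u₂) (u₁ - u₂) = 2 * herm q u₁ u₁ := herm_sub_self (by rw [hn1, hn2]) h12
  have h0 : u₁ - u₂ ≠ 0 := by
    intro h; rw [h, hn1] at hs; simp at hs
  have he : herm q e (u₁ - u₂) = 0 := by simp [h1, h2]
  have hf : herm q f (u₁ - u₂) = 0 := by simp [h1', h2']
  obtain ⟨k, hk, hkn⟩ := P.exists_smul he hf h0
  refine ⟨(k : ℂ) • (u₁ - u₂), by rw [map_smul, he, smul_zero], by rw [map_smul, hf, smul_zero],
    hkn, ?_⟩
  have h1s := biRefl_smul (c := e - f) (c' := u₁ - u₂) (k := 1) (k' := k) one_ne_zero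
    (by simpa using hk) (-1)
  rw [one_smul] at h1s
  rw [h1s]
  have hef : herm q (e - f) (e - f) ≠ 0 := by rw [P.herm_sub]; norm_num
  have hu1 : herm q u₁ u₁ ≠ 0 := by simp [hn1]
  have hu2 : herm q (u₁ - u₂) (u₁ - u₂) ≠ 0 := by rw [hs, hn1]; norm_num
  have horth : herm q (e - f) u₁ = 0 := by simp [h1, h1']
  apply SU_ext
  intro x
  rw [quarterTurn, act_biRefl hu1 hu2 (by simp), act_mul_apply, act_biRefl hef hu1 (by simp),
    act_biRefl hef hu2 (by simp), ← reflEnd_comm horth, reflEnd_reflEnd hef]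
  norm_num [reflEnd_one]

/-- The element `e ↦ i e`, `f ↦ i f`, `u ↦ -u`. -/
lemma exists_rotation (P : HypPair e f) {u : CVec q} (h1 : herm q e u = 0) (h2 : herm q f u = 0)
    (hu : u ≠ 0) : ∃ A : SU 1 q, act q A e = Complex.I • e ∧ act q A f = Complex.I • f ∧
      act q A u = -u := by
  have hI : Complex.I * (starRingEnd ℂ) Complex.I = 1 := by simp
  have hne := P.herm_self_ne h1 h2 hu
  have ha : herm q (e + f) (e + f) ≠ 0 := by rw [P.herm_add]; norm_num
  have hs : herm q (e - f) (e - f) ≠ 0 := by rw [P.herm_sub]; norm_num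
  have h1' := herm_eq_zero_comm h1
  have h2' := herm_eq_zero_comm h2
  have horth : herm q (e + f) (e - f) = 0 := by simp [P.ee, P.ff, P.ef, P.fe]
  have key1 : ∀ x, herm q u x = 0 → act q (biRefl (e + f) u Complex.I *
      biRefl (e - f) u Complex.I) x = reflEnd (e + f) Complex.I (reflEnd (e - f) Complex.I x) := by
    intro x hx
    rw [act_mul_apply, act_biRefl ha hne hI, act_biRefl hs hne hI, reflEnd_of_orth hx,
      reflEnd_of_orth (c := u)]
    simp [reflEnd_apply, h1', h2', hx]
  refine ⟨biRefl (e + f) u Complex.I * biRefl (e - f) u Complex.I, ?_, ?_, ?_⟩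
  · rw [key1 e h1', reflEnd_apply, reflEnd_apply, P.herm_add, P.herm_sub]
    simp only [map_add, map_sub, map_smul, LinearMap.sub_apply, LinearMap.add_apply, P.ee, P.ff,
      P.ef, P.fe, smul_eq_mul]
    module
  · rw [key1 f h2', reflEnd_apply, reflEnd_apply, P.herm_add, P.herm_sub]
    simp only [map_add, map_sub, map_smul, LinearMap.sub_apply, LinearMap.add_apply, P.ee, P.ff,
      P.ef, P.fe, smul_eq_mul]
    module
  · have hsu : herm q (e - f) u = 0 := by simp [h1, h2]
    have hau : herm q (e + f) u = 0 := by simp [h1, h2]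
    rw [act_mul_apply, act_biRefl hs hne hI, act_biRefl ha hne hI, reflEnd_self hne,
      map_smul, map_smul, map_smul, reflEnd_of_orth hsu, reflEnd_self hne, map_smul,
      reflEnd_of_orth hau, smul_smul]
    simp

/-- The element `e ↦ r e`, `f ↦ r⁻¹ f` which is trivial on the orthogonal complement. -/
lemma exists_boost (P : HypPair e f) {r : ℝ} (hr : 0 < r) :
    ∃ A : SU 1 q, act q A e = (r : ℂ) • e ∧ act q A f = (r⁻¹ : ℂ) • f ∧
      ∀ x, herm q e x = 0 → herm q f x = 0 → act q A x = x := by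
  have hr0 : (r : ℂ) ≠ 0 := by exact_mod_cast hr.ne'
  have ha : herm q (e + f) (e + f) ≠ 0 := by rw [P.herm_add]; norm_num
  have hb' : herm q ((r : ℂ) • e + f) ((r : ℂ) • e + f) = 2 * r := by
    simp only [map_add, map_smul, map_smulₛₗ, LinearMap.add_apply, LinearMap.smul_apply, P.ee, P.ff,
      P.ef, P.fe, smul_eq_mul, Complex.conj_ofReal]
    ring
  have hb : herm q ((r : ℂ) • e + f) ((r : ℂ) • e + f) ≠ 0 := by
    rw [hb']; simpa using hr0
  have hm : (-1 : ℂ) * (starRingEnd ℂ) (-1) = 1 := by simp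
  refine ⟨biRefl ((r : ℂ) • e + f) (e + f) (-1), ?_, ?_, ?_⟩
  · rw [act_biRefl hb ha hm, reflEnd_apply, reflEnd_apply, P.herm_add, hb']
    simp only [map_add, map_smul, map_smulₛₗ, LinearMap.add_apply, LinearMap.smul_apply, P.ee, P.ff,
      P.ef, P.fe, smul_eq_mul, Complex.conj_ofReal]
    match_scalars <;> field_simp <;> ring
  · rw [act_biRefl hb ha hm, reflEnd_apply, reflEnd_apply, P.herm_add, hb']
    simp only [map_add, map_smul, map_smulₛₗ, LinearMap.add_apply, LinearMap.smul_apply, P.ee, P.ff,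
      P.ef, P.fe, smul_eq_mul, Complex.conj_ofReal]
    match_scalars <;> field_simp <;> ring
  · intro x h1 h2
    exact act_biRefl_of_orth hb ha hm (by simp [h1, h2, -Complex.coe_smul]) (by simp [h1, h2])

lemma eichler_mem_of_forall (P : HypPair e f) {H : Subgroup (SU 1 q)}
    (hN : ∀ u, herm q e u = 0 → herm q f u = 0 → eichler e u 0 ∈ H) {u : CVec q}
    (hu : herm q e u = 0) (s : ℝ) : eichler e u s ∈ H := by
  have h0 : ∀ s, eichler e 0 s ∈ H := by
    intro s
    obtain ⟨v, v', h1, h2, h3, h4, h⟩ := P.exists_comm s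
    rw [← mul_inv_eq_iff_eq_mul] at h
    rw [← h]
    exact H.mul_mem (H.mul_mem (hN v h1 h2) (hN v' h3 h4))
      (H.inv_mem (H.mul_mem (hN v' h3 h4) (hN v h1 h2)))
  obtain ⟨u', s', h1, h2, h⟩ := P.eichler_eq hu s
  rw [h]
  exact H.mul_mem (hN u' h1 h2) (h0 s')

lemma herm_act_eichler_opposite (P : HypPair e f) {u : CVec q} (h1 : herm q e u = 0)
    (h2 : herm q f u = 0) (s : ℝ) :
    herm q e (act q (eichler f u s) e) = Complex.I * s - herm q u u / 2 := by
  rw [act_eichler P.ff h2]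
  simp [P.ee, P.ef, P.fe, h1, herm_eq_zero_comm h1]

/-- A subgroup containing two opposite unipotent radicals and normalized by the pointwise
stabilizer of the pair is the whole group. -/
lemma eq_top_of_eichler_mem (P : HypPair e f) (H : Subgroup (SU 1 q))
    (hNe : ∀ u, herm q e u = 0 → herm q f u = 0 → eichler e u 0 ∈ H)
    (hNf : ∀ u, herm q e u = 0 → herm q f u = 0 → eichler f u 0 ∈ H)
    (hnorm : ∀ σ, act q σ e = e → act q σ f = f → ∀ A ∈ H, σ * A * σ⁻¹ ∈ H) : H = ⊤ := by
  have hE : ∀ u s, herm q e u = 0 → eichler e u s ∈ H := fun u s hu =>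
    P.eichler_mem_of_forall hNe hu s
  have hF : ∀ u s, herm q f u = 0 → eichler f u s ∈ H := fun u s hu =>
    P.symm.eichler_mem_of_forall (fun u h1 h2 => hNf u h2 h1) hu s
  have hweyl : weyl e f ∈ H :=
    H.mul_mem (H.mul_mem (hE 0 1 (by simp)) (hF 0 1 (by simp))) (hE 0 1 (by simp))
  have hrefl : ∀ u, herm q e u = 0 → herm q f u = 0 → herm q u u = -2 →
      biRefl (e - f) u (-1) ∈ H := by
    intro u h1 h2 h3
    rw [← P.eichler_weyl h1 h2 h3]
    exact H.mul_mem (H.mul_mem (hE u 0 h1) (hF _ 0 (by simp [h2]))) (hE u 0 h1)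
  have hσ : ∀ σ, act q σ e = e → act q σ f = f → σ ∈ H := fun σ =>
    P.stabilizer_le H hnorm (by
      intro u₁ u₂ h1 h1' h2 h2' hn1 hn2 h12
      obtain ⟨v, hv1, hv2, hv3, hv⟩ := P.quarterTurn_eq h1 h1' h2 h2' hn1 hn2 h12
      rw [hv]
      exact H.mul_mem (hrefl _ h1 h1' hn1) (hrefl _ hv1 hv2 hv3))
  -- `H` contains elements with every value of `h(e, A e)`
  have hval : ∀ z : ℂ, 0 ≤ z.re → ∃ B ∈ H, herm q e (act q B e) = z := by
    intro z hz
    obtain ⟨u, h1, h2, h3⟩ := P.exists_norm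
    refine ⟨eichler f ((Real.sqrt z.re : ℂ) • u) z.im, hF _ _ (by simp [h2]), ?_⟩
    rw [P.herm_act_eichler_opposite (by simp [h1]) (by simp [h2])]
    have hsq : ((Real.sqrt z.re : ℝ) : ℂ) * (Real.sqrt z.re : ℝ) = z.re := by
      rw [← Complex.ofReal_mul, Real.mul_self_sqrt hz]
    simp only [map_smul, map_smulₛₗ, LinearMap.smul_apply, smul_eq_mul, Complex.conj_ofReal]
    rw [← mul_assoc, hsq, h3]
    conv_rhs => rw [← Complex.re_add_im z]
    ring
  have hval' : ∀ z : ℂ, ∃ B ∈ H, herm q e (act q B e) = z := by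
    intro z
    rcases le_total 0 z.re with hz | hz
    · exact hval z hz
    · obtain ⟨B, hB, hBz⟩ := hval (-z) (by simpa using hz)
      refine ⟨B * centralInv e f, H.mul_mem hB (H.mul_mem hweyl hweyl), ?_⟩
      rw [act_mul_apply, P.act_centralInv_left, map_neg, map_neg, hBz, neg_neg]
  have hgen : ∀ A, herm q e (act q A e) ≠ 0 → A ∈ H := by
    intro A hA
    obtain ⟨B, hB, hBz⟩ := hval' (herm q e (act q A e))
    obtain ⟨u, s, u', s', σ, hu, hu', h1, h2, h⟩ := P.exists_factorization (A := A) (B := B)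
      hBz.symm (by rwa [hBz])
    rw [h]
    exact H.mul_mem (H.mul_mem (H.mul_mem (hE u s hu) hB) (hE u' s' hu')) (hσ σ h1 h2)
  rw [eq_top_iff]
  intro A _
  by_cases hA : herm q e (act q A e) = 0
  · have hz := P.eq_smul_of_isotropic (x := act q A e) (by rw [herm_act, P.ee]) hA
    have hne : herm q f (act q A e) ≠ 0 := by
      intro h
      rw [h, zero_smul] at hz
      have h1 : herm q (act q A e) (act q A f) = 1 := by rw [herm_act, P.ef]
      rw [hz] at h1
      simp at h1
    have hwA : weyl e f * A ∈ H := by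
      apply hgen
      rw [act_mul_apply, hz, map_smul, P.act_weyl_left]
      simpa [P.ef] using hne
    have := H.mul_mem (H.inv_mem hweyl) hwA
    rwa [inv_mul_cancel_left] at this
  · exact hgen A hA

/-- `SU(1, q)` is the normal closure of a single central element of a Heisenberg group. -/
lemma eq_top_of_normal (P : HypPair e f) (H : Subgroup (SU 1 q)) [hH : H.Normal]
    (h : eichler e 0 1 ∈ H) : H = ⊤ := by
  have hm : (-1 : ℂ) * (starRingEnd ℂ) (-1) = 1 := by simp
  obtain ⟨u, h1, h2, h3⟩ := P.exists_norm
  have hs : herm q (e - f) (e - f) ≠ 0 := by rw [P.herm_sub]; norm_num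
  have hu : herm q u u ≠ 0 := by rw [h3]; norm_num
  have hsw : act q (biRefl (e - f) u (-1)) e = f := by
    rw [act_biRefl hs hu hm, reflEnd_of_orth (herm_eq_zero_comm h1), reflEnd_apply, P.herm_sub]
    simp [P.ee, P.fe]
    norm_num
  have hf : eichler f 0 1 ∈ H := by
    have := hH.conj_mem _ h (biRefl (e - f) u (-1))
    rwa [conj_eichler P.ee (by simp), hsw, map_zero] at this
  have hweyl : weyl e f ∈ H := H.mul_mem (H.mul_mem h hf) h
  have hinv : centralInv e f ∈ H := H.mul_mem hweyl hweyl
  have key : ∀ (c v : CVec q), herm q c c = 0 → herm q c v = 0 → act q (centralInv e f) c = -c →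
      act q (centralInv e f) v = v → eichler c v 0 ∈ H := by
    intro c v hc hcv hac hav
    have hcv' : herm q c ((2⁻¹ : ℂ) • v) = 0 := by simp [hcv]
    have h4 := H.mul_mem (hH.conj_mem _ hinv (eichler c ((2⁻¹ : ℂ) • v) 0)) (H.inv_mem hinv)
    rw [mul_assoc, mul_assoc, ← mul_assoc (centralInv e f), eichler_inv hc hcv',
      conj_eichler hc (by simp [hcv]), hac, map_neg, map_smul, hav] at h4
    have h5 : eichler (-c) (-((2⁻¹ : ℂ) • v)) (-0) = eichler c ((2⁻¹ : ℂ) • v) 0 := by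
      have := eichler_smul hc (u := -((2⁻¹ : ℂ) • v)) (by simp [hcv]) 0 (-1)
      simpa using this
    rw [h5, eichler_mul hc hcv' hcv'] at h4
    have h6 : (2⁻¹ : ℂ) • v + (2⁻¹ : ℂ) • v = v := by module
    simpa [h6, herm_self_im] using h4
  refine P.eq_top_of_eichler_mem H ?_ ?_ ?_
  · exact fun v hv1 hv2 => key e v P.ee hv1 P.act_centralInv_left (P.act_centralInv_of_orth hv1 hv2)
  · exact fun v hv1 hv2 => key f v P.ff hv2 P.act_centralInv_right
      (P.act_centralInv_of_orth hv1 hv2)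
  · exact fun σ _ _ A hA => hH.conj_mem A hA σ

end HypPair

/-! ### Unipotent isometries of real quadratic spaces of small index -/

section LinearAlgebra

variable {V : Type*} [AddCommGroup V] [Module ℝ V]

lemma eigenvalue_eq_zero_of_isNilpotent {T : Module.End ℝ V} (hT : IsNilpotent T) {w : V} {α : ℝ}
    (hw : w ≠ 0) (h : T w = α • w) : α = 0 := by
  obtain ⟨k, hk⟩ := hT
  have hpow : ∀ k : ℕ, (T ^ k) w = α ^ k • w := by
    intro k
    induction k with
    | zero => simp
    | succ k ih => rw [pow_succ', Module.End.mul_apply, ih, map_smul, h, smul_smul, pow_succ]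
  have := hpow k
  rw [hk, LinearMap.zero_apply] at this
  rcases smul_eq_zero.1 this.symm with h | h
  · exact by_contra fun hα => pow_ne_zero k hα h
  · exact absurd h hw

lemma coeff_eq_zero_of_isNilpotent {T : Module.End ℝ V} (hT : IsNilpotent T) {x y : V} {α β : ℝ}
    (hx : x ∉ Submodule.span ℝ {y}) (hy : T y = 0) (h : T x = α • x + β • y) : α = 0 := by
  by_contra hα
  refine hα (eigenvalue_eq_zero_of_isNilpotent hT (w := x + (β / α) • y) (α := α) ?_ ?_)
  · intro h0
    apply hx
    rw [Submodule.mem_span_singleton]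
    exact ⟨-(β / α), by rw [neg_smul]; exact (eq_neg_of_add_eq_zero_left h0).symm⟩
  · rw [map_add, map_smul, hy, h, smul_zero, add_zero, smul_add, smul_smul, mul_div_cancel₀ _ hα]

lemma exists_mem_map_eq_zero {T : Module.End ℝ V} (hT : IsNilpotent T) {W : Submodule ℝ V}
    (hW : ∀ x ∈ W, T x ∈ W) {x : V} (hx : x ∈ W) (hx0 : x ≠ 0) :
    ∃ y ∈ W, y ≠ 0 ∧ T y = 0 := by
  obtain ⟨k, hk⟩ := hT
  have hpow : ∀ k : ℕ, (T ^ k) x ∈ W := by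
    intro k
    induction k with
    | zero => simpa using hx
    | succ k ih => rw [pow_succ', Module.End.mul_apply]; exact hW _ ih
  have hex : ∃ k, (T ^ k) x = 0 := ⟨k, by simp [hk]⟩
  classical
  have h1 := Nat.find_spec hex
  have h0 : Nat.find hex ≠ 0 := by
    intro h
    rw [h] at h1
    exact hx0 (by simpa using h1)
  obtain ⟨m, hm⟩ := Nat.exists_eq_succ_of_ne_zero h0
  refine ⟨(T ^ m) x, hpow m, Nat.find_min hex (by omega), ?_⟩
  rw [hm, Nat.succ_eq_add_one, pow_succ', Module.End.mul_apply] at h1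
  exact h1

variable {b : LinearMap.BilinForm ℝ V}

/-- A unipotent isometry acts trivially on a definite space; here the space is `W / R`, where `R`
is the radical of `W`. -/
lemma sub_mem_of_unipotent (hsymm : ∀ x y, b x y = b y x) {g : Module.End ℝ V}
    (hg : ∀ x y, b (g x) (g y) = b x y) (hnil : IsNilpotent (g - 1)) {W R : Submodule ℝ V}
    (hR : ∀ x ∈ W, ∀ r ∈ R, b x r = 0) (hW : ∀ x ∈ W, g x ∈ W)
    (hdef : ∀ x ∈ W, b x x = 0 → x ∈ R) : ∀ x ∈ W, g x - x ∈ R := by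
  have hDW : ∀ x ∈ W, (g - 1) x ∈ W := fun x hx => W.sub_mem (hW x hx) hx
  have hstep : ∀ y ∈ W, (g - 1) ((g - 1) y) ∈ R → (g - 1) y ∈ R := by
    intro y hy h
    refine hdef _ (hDW y hy) ?_
    set z := (g - 1) y with hz
    have h1 : g z = z + (g - 1) z := by simp
    have h2 : g y = y + z := by rw [hz]; simp
    have h3 := hg z y
    rw [h1, h2] at h3
    have h4 : b ((g - 1) z) (y + z) = 0 := by
      rw [hsymm]; exact hR _ (W.add_mem hy (hDW y hy)) _ h
    simp only [map_add, LinearMap.add_apply] at h3 h4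
    linarith
  have hpow : ∀ k : ℕ, ∀ x ∈ W, ((g - 1) ^ (k + 1)) x ∈ R → (g - 1) x ∈ R := by
    intro k
    induction k with
    | zero => intro x _ h; simpa using h
    | succ k ih =>
      intro x hx h
      apply hstep x hx
      apply ih _ (hDW x hx)
      rw [pow_succ, Module.End.mul_apply] at h
      exact h
  obtain ⟨k, hk⟩ := hnil
  intro x hx
  refine hpow k x hx ?_
  rw [pow_succ', hk]
  simp

/-- Isometries which fix an isotropic vector `e` and act trivially on `e^⊥ / e` commute. The
statement is relative to a space `W / R`, where `R` is contained in the radical of `W`. -/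
lemma commute_mod_of_trivial (hsymm : ∀ x y, b x y = b y x) {g g' : Module.End ℝ V}
    (hg : ∀ x y, b (g x) (g y) = b x y) (hg' : ∀ x y, b (g' x) (g' y) = b x y)
    {W R : Submodule ℝ V} (hR : ∀ x ∈ W, ∀ r ∈ R, b x r = 0)
    (hW : ∀ x ∈ W, g x ∈ W) (hW' : ∀ x ∈ W, g' x ∈ W)
    (hgR : ∀ x ∈ R, g x ∈ R) (hgR' : ∀ x ∈ R, g' x ∈ R) {e : V}
    (hge : g e - e ∈ R) (hge' : g' e - e ∈ R)
    (ht : ∀ x ∈ W, b e x = 0 → ∃ c : ℝ, g x - x - c • e ∈ R)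
    (ht' : ∀ x ∈ W, b e x = 0 → ∃ c : ℝ, g' x - x - c • e ∈ R) {y : V} (hy : y ∈ W) :
    g (g' y) - g' (g y) ∈ R := by
  have horth : ∀ (k : Module.End ℝ V), (∀ x y, b (k x) (k y) = b x y) → (∀ x ∈ W, k x ∈ W) →
      k e - e ∈ R → b e (k y - y) = 0 := by
    intro k hk hkW hke
    have h1 := hk e y
    have h2 : b (k e - e) (k y) = 0 := by rw [hsymm]; exact hR _ (hkW y hy) _ hke
    simp only [map_sub, LinearMap.sub_apply] at h2 ⊢
    linarith
  -- the coefficient of `e` in `(g - 1) (g' - 1) y`, in a form symmetric in `g` and `g'`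
  have hcoef : ∀ (k k' : Module.End ℝ V), (∀ x y, b (k x) (k y) = b x y) →
      (∀ x y, b (k' x) (k' y) = b x y) → (∀ x ∈ W, k x ∈ W) → (∀ x ∈ W, k' x ∈ W) →
      k e - e ∈ R → k' e - e ∈ R →
      (∀ x ∈ W, b e x = 0 → ∃ c : ℝ, k x - x - c • e ∈ R) →
      ∃ c : ℝ, k (k' y - y) - (k' y - y) - c • e ∈ R ∧
        c * b e y = -b (k' y - y) (k y - y) := by
    intro k k' hk hk' hkW hkW' hke hke' hkt
    obtain ⟨c, hc⟩ := hkt (k' y - y) (W.sub_mem (hkW' y hy) hy) (horth k' hk' hkW' hke')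
    refine ⟨c, hc, ?_⟩
    have h1 := hk (k' y - y) y
    have h2 : k (k' y - y) = (k' y - y) + c • e + (k (k' y - y) - (k' y - y) - c • e) := by abel
    have h3 : b (k (k' y - y) - (k' y - y) - c • e) (k y) = 0 := by
      rw [hsymm]; exact hR _ (hkW y hy) _ hc
    have h5 := horth k hk hkW hke
    rw [h2, map_add, map_add, LinearMap.add_apply, LinearMap.add_apply, h3] at h1
    rw [map_smul, LinearMap.smul_apply, smul_eq_mul] at h1
    have h6 : b e (k y) = b e y := by
      rw [map_sub] at h5; linarith
    rw [h6] at h1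
    rw [map_sub (b (k' y - y))]
    linarith
  have hdiff : g (g' y) - g' (g y) =
      (g (g' y - y) - (g' y - y)) - (g' (g y - y) - (g y - y)) := by
    simp only [map_sub]; abel
  rw [hdiff]
  by_cases hey : b e y = 0
  · have hzero : ∀ (k k' : Module.End ℝ V), (∀ x ∈ R, k x ∈ R) → k e - e ∈ R →
        (∀ x ∈ W, b e x = 0 → ∃ c : ℝ, k' x - x - c • e ∈ R) →
        k (k' y - y) - (k' y - y) ∈ R := by
      intro k k' hkR hke hkt'
      obtain ⟨c, hc⟩ := hkt' y hy hey
      have h2 : k (k' y - y) - (k' y - y) =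
          k (k' y - y - c • e) - (k' y - y - c • e) + c • (k e - e) := by
        simp only [map_sub, map_smul]; module
      rw [h2]
      exact R.add_mem (R.sub_mem (hkR _ hc) hc) (R.smul_mem _ hke)
    exact R.sub_mem (hzero g g' hgR hge ht') (hzero g' g hgR' hge' ht)
  · obtain ⟨c, hc, h1⟩ := hcoef g g' hg hg' hW hW' hge hge' ht
    obtain ⟨c', hc', h2⟩ := hcoef g' g hg' hg hW' hW hge' hge ht'
    have hcc : c = c' := by
      apply mul_right_cancel₀ hey
      rw [h1, h2, hsymm]
    have := R.sub_mem hc hc'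
    rw [hcc] at this
    convert this using 1
    abel

lemma finrank_le_two_of_nonneg
    (hidx : ∀ W : Submodule ℝ V, 3 ≤ Module.finrank ℝ W → ∃ x ∈ W, b x x < 0)
    {W : Submodule ℝ V} (hW : ∀ x ∈ W, 0 ≤ b x x) : Module.finrank ℝ W ≤ 2 := by
  by_contra h
  obtain ⟨x, hx, hneg⟩ := hidx W (by omega)
  exact absurd (hW x hx) (not_le.2 hneg)

variable [FiniteDimensional ℝ V]

/-- A maximal isotropic subspace `L` is the set of vectors of nonnegative square in `L^⊥`. -/
lemma mem_of_orthogonal_of_nonneg (hsymm : ∀ x y, b x y = b y x)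
    (hidx : ∀ W : Submodule ℝ V, 3 ≤ Module.finrank ℝ W → ∃ x ∈ W, b x x < 0)
    {L : Submodule ℝ V} (hL : Module.finrank ℝ L = 2) (hiso : ∀ x ∈ L, b x x = 0) {x : V}
    (hx : ∀ y ∈ L, b x y = 0) (hxx : 0 ≤ b x x) : x ∈ L := by
  by_contra hxL
  have hlt : L < L ⊔ Submodule.span ℝ {x} := by
    refine lt_of_le_of_ne le_sup_left fun h => hxL ?_
    rw [h]
    exact Submodule.mem_sup_right (Submodule.mem_span_singleton_self x)
  have h1 := Submodule.finrank_lt_finrank_of_lt hlt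
  have h2 : Module.finrank ℝ (L ⊔ Submodule.span ℝ {x} : Submodule ℝ V) ≤ 2 := by
    apply finrank_le_two_of_nonneg hidx
    intro v hv
    obtain ⟨y, hy, z, hz, rfl⟩ := Submodule.mem_sup.1 hv
    obtain ⟨c, rfl⟩ := Submodule.mem_span_singleton.1 hz
    simp only [map_add, map_smul, LinearMap.add_apply, LinearMap.smul_apply, smul_eq_mul,
      hiso y hy, hx y hy, hsymm y x]
    nlinarith [mul_nonneg (mul_self_nonneg c) hxx]
  omega

lemma exists_smul_add_smul_of_finrank_eq_two {L : Submodule ℝ V} (hL : Module.finrank ℝ L = 2)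
    {x y : V} (hx : x ∈ L) (hy : y ∈ L) (hy0 : y ≠ 0) (hxy : x ∉ Submodule.span ℝ {y}) {v : V}
    (hv : v ∈ L) : ∃ α β : ℝ, v = α • x + β • y := by
  have hle : Submodule.span ℝ {x, y} ≤ L := by
    rw [Submodule.span_le]
    rintro z (rfl | rfl)
    · exact hx
    · exact hy
  have hlt : Submodule.span ℝ {y} < Submodule.span ℝ {x, y} := by
    refine lt_of_le_of_ne (Submodule.span_mono (by simp)) fun h => hxy ?_
    rw [h]
    exact Submodule.subset_span (by simp)
  have h1 := Submodule.finrank_lt_finrank_of_lt hlt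
  rw [finrank_span_singleton hy0] at h1
  have h2 : Submodule.span ℝ {x, y} = L :=
    Submodule.eq_of_le_of_finrank_le hle (by omega)
  rw [← h2, Submodule.mem_span_pair] at hv
  obtain ⟨α, β, h⟩ := hv
  exact ⟨α, β, h.symm⟩

end LinearAlgebra

/-! ### Commutators of unipotent isometries -/

section Commutator

variable {V : Type*} [AddCommGroup V] [Module ℝ V] {b : LinearMap.BilinForm ℝ V}

/-- The adjoint of `z - 1` is `z⁻¹ - 1 = -z⁻¹ (z - 1)`; this is the `k`-th power of that
identity. -/
lemma isometry_sub_one_pow {z : Module.End ℝ V} (hz : ∀ x y, b (z x) (z y) = b x y) (k : ℕ) :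
    ∀ x y, b (((z - 1) ^ k) x) ((z ^ k) y) = (-1) ^ k * b x (((z - 1) ^ k) y) := by
  induction k with
  | zero => simp
  | succ k ih =>
    intro x y
    have hc : Commute z (z - 1) := (Commute.refl z).sub_right (Commute.one_right z)
    rw [pow_succ (z - 1) k, Module.End.mul_apply, pow_succ z, Module.End.mul_apply, ih,
      ← Module.End.mul_apply _ z, ← (hc.pow_right k).eq, Module.End.mul_apply,
      Module.End.mul_apply]
    have h1 : ∀ u v, b ((z - 1) u) (z v) = - b u ((z - 1) v) := by
      intro u v
      simp only [LinearMap.sub_apply, Module.End.one_apply, map_sub, hz]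
      ring
    rw [h1, ← Module.End.mul_apply (z - 1), ← Module.End.mul_apply ((z - 1) ^ k), ← pow_succ',
      ← pow_succ]
    ring

lemma isometry_sub_one_pow_pow {z : Module.End ℝ V} (hz : ∀ x y, b (z x) (z y) = b x y)
    (k m : ℕ) (x y : V) :
    b (((z - 1) ^ k) x) (((z - 1) ^ m) ((z ^ k) y)) = (-1) ^ k * b x (((z - 1) ^ (k + m)) y) := by
  have hc : Commute z (z - 1) := (Commute.refl z).sub_right (Commute.one_right z)
  rw [← Module.End.mul_apply _ (z ^ k), ← (hc.pow_pow k m).eq, Module.End.mul_apply,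
    isometry_sub_one_pow hz, pow_add, Module.End.mul_apply]

variable [FiniteDimensional ℝ V]

/-- A commutator `z` of two unipotent isometries which commute with `z` satisfies
`(z - 1)² = 0` if the quadratic form has index at most two. The image of the highest nonzero
power of `z - 1` contains an isotropic vector `e` fixed by all three isometries. On `e^⊥ / e` the
index is at most one, which makes the isometries commute there, so that `z - 1` maps `e^⊥` to
the line of `e`. -/
lemma sub_one_sq_of_commutator (hsymm : ∀ x y, b x y = b y x)
    (hidx : ∀ W : Submodule ℝ V, 3 ≤ Module.finrank ℝ W → ∃ x ∈ W, b x x < 0)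
    {g g' z : Module.End ℝ V}
    (hg : ∀ x y, b (g x) (g y) = b x y) (hg' : ∀ x y, b (g' x) (g' y) = b x y)
    (hz : ∀ x y, b (z x) (z y) = b x y)
    (hgs : Function.Surjective g) (hgs' : Function.Surjective g') (hzs : Function.Surjective z)
    (hgn : IsNilpotent (g - 1)) (hgn' : IsNilpotent (g' - 1)) (hzn : IsNilpotent (z - 1))
    (hcomm : ∀ x, g (g' x) = z (g' (g x))) (hzg : ∀ x, z (g x) = g (z x))
    (hzg' : ∀ x, z (g' x) = g' (z x)) (x : V) : (z - 1) ((z - 1) x) = 0 := by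
  set D := z - 1 with hD
  have hDz : ∀ x, D x = z x - x := fun x => rfl
  have hzD : ∀ x, z x = x + D x := fun x => by rw [hDz]; abel
  have hgD : ∀ k x, g ((D ^ k) x) = (D ^ k) (g x) := by
    intro k x
    have : Commute g D := by
      refine Commute.sub_right ?_ (Commute.one_right _)
      exact LinearMap.ext fun x => (hzg x).symm
    exact LinearMap.congr_fun (this.pow_right k).eq x
  have hgD' : ∀ k x, g' ((D ^ k) x) = (D ^ k) (g' x) := by
    intro k x
    have : Commute g' D := by
      refine Commute.sub_right ?_ (Commute.one_right _)
      exact LinearMap.ext fun x => (hzg' x).symm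
    exact LinearMap.congr_fun (this.pow_right k).eq x
  by_cases hD0 : D = 0
  · simp [hD0]
  -- the highest nonzero power of `D`
  obtain ⟨k, hk1, hk, hk'⟩ : ∃ k, 1 ≤ k ∧ D ^ k ≠ 0 ∧ D ^ (k + 1) = 0 := by
    classical
    have h1 := Nat.find_spec hzn
    have h0 : Nat.find hzn ≠ 0 := by
      intro h
      rw [h, pow_zero] at h1
      apply hD0
      rw [← mul_one D, h1, mul_zero]
    have h2 : Nat.find hzn ≠ 1 := by
      intro h
      rw [h, pow_one] at h1
      exact hD0 h1
    obtain ⟨m, hm⟩ := Nat.exists_eq_succ_of_ne_zero h0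
    exact ⟨m, by omega, Nat.find_min hzn (by omega), by rw [← Nat.succ_eq_add_one, ← hm]; exact h1⟩
  have hDk : ∀ x, D ((D ^ k) x) = 0 := by
    intro x
    rw [← Module.End.mul_apply, ← pow_succ', hk', LinearMap.zero_apply]
  -- a common fixed isotropic vector
  obtain ⟨e, he0, hge, hge', hDe, hee⟩ : ∃ e, e ≠ 0 ∧ g e = e ∧ g' e = e ∧ D e = 0 ∧
      b e e = 0 := by
    obtain ⟨a, ha⟩ : ∃ a, (D ^ k) a ≠ 0 := by
      by_contra h
      push Not at h
      exact hk (LinearMap.ext h)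
    obtain ⟨y, hy, hy0, hgy⟩ := exists_mem_map_eq_zero hgn (W := LinearMap.range (D ^ k))
      (by
        rintro _ ⟨v, rfl⟩
        refine ⟨g v - v, ?_⟩
        rw [map_sub, ← hgD]; rfl) ⟨a, rfl⟩ ha
    obtain ⟨e, ⟨⟨v, hv⟩, he⟩, he0, hge'⟩ := exists_mem_map_eq_zero hgn'
      (W := LinearMap.range (D ^ k) ⊓ LinearMap.ker (g - 1))
      (by
        rintro w ⟨⟨v, hv⟩, hw⟩
        have hw1 : g w = w := sub_eq_zero.1 (LinearMap.mem_ker.1 hw)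
        have hzw : ∀ w ∈ LinearMap.range (D ^ k), z w = w := by
          rintro _ ⟨v, rfl⟩
          rw [hzD, hDk, add_zero]
        have hmem : g' w ∈ LinearMap.range (D ^ k) := by
          rw [← hv, hgD']; exact ⟨_, rfl⟩
        refine ⟨Submodule.sub_mem _ hmem ⟨v, hv⟩, ?_⟩
        refine LinearMap.mem_ker.2 ?_
        change g (g' w - w) - (g' w - w) = 0
        rw [map_sub, hcomm, hw1, hzw _ hmem, sub_self])
      ⟨hy, LinearMap.mem_ker.2 hgy⟩ hy0
    have hge : g e = e := sub_eq_zero.1 (LinearMap.mem_ker.1 he)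
    have hge' : g' e = e := sub_eq_zero.1 hge'
    refine ⟨e, he0, hge, hge', by rw [← hv, hDk], ?_⟩
    obtain ⟨v', hv'⟩ : ∃ v', (z ^ k) v' = v := by
      rw [Module.End.coe_pow]; exact hzs.iterate k v
    have h := isometry_sub_one_pow_pow hz k k v v'
    rw [hv', ← hD, hv] at h
    rw [h, show k + k = (k + 1) + (k - 1) by omega, pow_add, hk', zero_mul]
    simp
  have hze : z e = e := by rw [hzD, hDe, add_zero]
  set R := Submodule.span ℝ {e} with hR
  have hfix : ∀ (T : Module.End ℝ V), T e = e → ∀ r ∈ R, T r = r := by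
    intro T hT r hr
    obtain ⟨c, rfl⟩ := Submodule.mem_span_singleton.1 hr
    rw [map_smul, hT]
  set W := LinearMap.ker (b e) with hW
  have hWmem : ∀ x, x ∈ W ↔ b e x = 0 := fun x => LinearMap.mem_ker
  have hWR : ∀ x ∈ W, ∀ r ∈ R, b x r = 0 := by
    intro x hx r hr
    obtain ⟨c, rfl⟩ := Submodule.mem_span_singleton.1 hr
    rw [map_smul, hsymm, (hWmem x).1 hx, smul_zero]
  have hinv : ∀ (T : Module.End ℝ V), T e = e → (∀ x y, b (T x) (T y) = b x y) → ∀ x,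
      b e (T x) = b e x := by
    intro T hTe hT x
    conv_lhs => rw [← hTe]
    exact hT e x
  have hWinv : ∀ (T : Module.End ℝ V), T e = e → (∀ x y, b (T x) (T y) = b x y) →
      ∀ x, T x ∈ W ↔ x ∈ W := by
    intro T hTe hT x
    rw [hWmem, hWmem, hinv T hTe hT]
  have hVW : ∀ (T : Module.End ℝ V), T e = e → (∀ x y, b (T x) (T y) = b x y) → ∀ x,
      T x - x ∈ W := by
    intro T hTe hT x
    rw [hWmem, map_sub, hinv T hTe hT, sub_self]
  have hDW : ∀ x, D x ∈ W := hVW z hze hz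
  have hDR : ∀ r ∈ R, D r = 0 := fun r hr => by rw [hDz, hfix z hze r hr, sub_self]
  have hDkW : ∀ j, ∀ x ∈ W, (D ^ j) x ∈ W := by
    intro j
    induction j with
    | zero => intro x hx; simpa using hx
    | succ j ih => intro x _; rw [pow_succ', Module.End.mul_apply]; exact hDW _
  -- `z` acts trivially on `e^⊥ / e`
  have hstep : ∀ j, 1 ≤ j → (∀ x ∈ W, (D ^ (j + 1)) x ∈ R) → ∀ x ∈ W, (D ^ j) x ∈ R := by
    intro j hj hj1
    by_contra hcon
    push Not at hcon
    obtain ⟨a, haW, ha⟩ := hcon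
    set e' := (D ^ j) a with he'
    set M := (W.map (D ^ j)) ⊔ R with hM
    have hmap : ∀ x ∈ W.map (D ^ j), ∀ y ∈ W.map (D ^ j), b x y = 0 := by
      rintro _ ⟨x, hx, rfl⟩ _ ⟨y, hy, rfl⟩
      obtain ⟨y', rfl⟩ : ∃ y', (z ^ j) y' = y := by
        rw [Module.End.coe_pow]; exact hzs.iterate j y
      have hzj : ∀ j : ℕ, (z ^ j) e = e ∧ ∀ x y, b ((z ^ j) x) ((z ^ j) y) = b x y := by
        intro j
        induction j with
        | zero => simp
        | succ j ih =>
          refine ⟨by rw [pow_succ, Module.End.mul_apply, hze, ih.1], fun x y => ?_⟩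
          rw [pow_succ, Module.End.mul_apply, Module.End.mul_apply, ih.2, hz]
      have hy' : y' ∈ W := (hWinv _ (hzj j).1 (hzj j).2 y').1 hy
      rw [hD, isometry_sub_one_pow_pow hz, ← hD]
      have : (D ^ (j + j)) y' ∈ R := by
        have h1 := hj1 _ (hDkW (j - 1) y' hy')
        rwa [← Module.End.mul_apply, ← pow_add, show j + 1 + (j - 1) = j + j by omega] at h1
      rw [hWR x hx _ this, mul_zero]
    have hMW : M ≤ W := by
      apply sup_le
      · rintro _ ⟨x, hx, rfl⟩
        exact hDkW j x hx
      · rw [hR, Submodule.span_le]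
        rintro _ rfl
        exact (hWmem _).2 hee
    have hMiso : ∀ x ∈ M, ∀ y ∈ M, b x y = 0 := by
      intro x hx y hy
      obtain ⟨x1, hx1, x2, hx2, rfl⟩ := Submodule.mem_sup.1 hx
      obtain ⟨y1, hy1, y2, hy2, rfl⟩ := Submodule.mem_sup.1 hy
      have h1 : b (x1 + x2) y2 = 0 := hWR _ (hMW hx) _ hy2
      have h2 : b x2 y1 = 0 := by
        rw [hsymm]; exact hWR _ (hMW (Submodule.mem_sup_left hy1)) _ hx2
      rw [map_add, h1, map_add, LinearMap.add_apply, h2, hmap x1 hx1 y1 hy1]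
      simp
    have he'M : e' ∈ M := Submodule.mem_sup_left ⟨a, haW, rfl⟩
    have heM : e ∈ M := Submodule.mem_sup_right (Submodule.mem_span_singleton_self e)
    have hM2 : Module.finrank ℝ M = 2 := by
      apply le_antisymm
      · exact finrank_le_two_of_nonneg hidx fun x hx => (hMiso x hx x hx).ge
      · have hlt : R < M := by
          refine lt_of_le_of_ne le_sup_right fun h => ha ?_
          rw [h]; exact he'M
        have h1 := Submodule.finrank_lt_finrank_of_lt hlt
        rw [hR, finrank_span_singleton he0] at h1
        omega
    have hMe : ∀ v ∈ M, ∃ c : ℝ, v - c • e' ∈ R := by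
      intro v hv
      obtain ⟨α, β, h⟩ := exists_smul_add_smul_of_finrank_eq_two hM2 he'M heM he0 ha hv
      refine ⟨α, ?_⟩
      rw [h, add_sub_cancel_left]
      exact R.smul_mem _ (Submodule.mem_span_singleton_self e)
    have hprop : ∀ (T : Module.End ℝ V), T e = e → (∀ x y, b (T x) (T y) = b x y) →
        IsNilpotent (T - 1) → (∀ k x, T ((D ^ k) x) = (D ^ k) (T x)) →
        (T e' - e' ∈ R) ∧ ∀ x ∈ W, b e' x = 0 → ∃ c : ℝ, T x - x - c • e' ∈ R := by
      intro T hTe hT hTn hTD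
      have hTM : ∀ x ∈ M, T x ∈ M := by
        intro x hx
        obtain ⟨x1, ⟨v, hv, rfl⟩, x2, hx2, rfl⟩ := Submodule.mem_sup.1 hx
        rw [map_add, hTD, hfix T hTe x2 hx2]
        exact Submodule.add_mem_sup ⟨T v, (hWinv T hTe hT v).2 hv, rfl⟩ hx2
      have hTe' : T e' - e' ∈ R := by
        obtain ⟨α, β, h⟩ := exists_smul_add_smul_of_finrank_eq_two hM2 he'M heM he0 ha
          (M.sub_mem (hTM e' he'M) he'M)
        have h0 : α = 0 := coeff_eq_zero_of_isNilpotent hTn ha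
          (by simp [hTe]) h
        rw [h, h0, zero_smul, zero_add]
        exact R.smul_mem _ (Submodule.mem_span_singleton_self e)
      refine ⟨hTe', ?_⟩
      · intro x hx hxe'
        set N : Submodule ℝ V := W ⊓ LinearMap.ker (b e') with hN
        have hNM : ∀ x ∈ N, ∀ y ∈ M, b x y = 0 := by
          intro x hx y hy
          obtain ⟨c, hc⟩ := hMe y hy
          have h1 := hWR x hx.1 _ hc
          have h2 : b x e' = 0 := by rw [hsymm]; exact LinearMap.mem_ker.1 hx.2
          rw [map_sub, map_smul, h2, smul_zero, sub_zero] at h1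
          exact h1
        have hMN : ∀ x, (∀ y ∈ M, b x y = 0) → x ∈ N := fun x h =>
          ⟨(hWmem x).2 (by rw [hsymm]; exact h e heM),
            LinearMap.mem_ker.2 (by rw [hsymm]; exact h e' he'M)⟩
        have hTM' : ∀ y ∈ M, ∃ y' ∈ M, T y' = y := by
          intro y hy
          obtain ⟨c, hc⟩ := hMe y hy
          have hr : (y - c • e') - c • (T e' - e') ∈ R := R.sub_mem hc (R.smul_mem _ hTe')
          refine ⟨c • e' + ((y - c • e') - c • (T e' - e')),
            M.add_mem (M.smul_mem _ he'M) (Submodule.mem_sup_right hr), ?_⟩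
          rw [map_add, hfix T hTe _ hr, map_smul]
          module
        have hmain := sub_mem_of_unipotent hsymm hT hTn hNM
          (fun x hx => hMN _ fun y hy => by
            obtain ⟨y', hy', rfl⟩ := hTM' y hy
            rw [hT]; exact hNM x hx y' hy')
          (fun x hx hxx => mem_of_orthogonal_of_nonneg hsymm hidx hM2
            (fun y hy => hMiso y hy y hy) (hNM x hx) hxx.ge) x
          ⟨hx, LinearMap.mem_ker.2 hxe'⟩
        exact hMe _ hmain
    obtain ⟨hp1, hp2⟩ := hprop g hge hg hgn hgD
    obtain ⟨hp1', hp2'⟩ := hprop g' hge' hg' hgn' hgD'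
    apply ha
    have hDR1 : ∀ y ∈ W, D y ∈ R := by
      intro y hy
      obtain ⟨v, rfl⟩ := hgs' y
      obtain ⟨w, rfl⟩ := hgs v
      have hw : w ∈ W := by rwa [hWinv g' hge' hg', hWinv g hge hg] at hy
      rw [hDz, ← hcomm]
      exact commute_mod_of_trivial hsymm hg hg' hWR (fun x => (hWinv g hge hg x).2)
        (fun x => (hWinv g' hge' hg' x).2) (fun r hr => by rwa [hfix g hge r hr])
        (fun r hr => by rwa [hfix g' hge' r hr]) hp1 hp1' hp2 hp2' hw
    rw [he', show j = (j - 1) + 1 by omega, pow_succ', Module.End.mul_apply]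
    exact hDR1 _ (hDkW _ a haW)
  have hDWR : ∀ x ∈ W, D x ∈ R := by
    have hdown : ∀ i, ∀ j, 1 ≤ j → j + i = k + 1 → ∀ x ∈ W, (D ^ j) x ∈ R := by
      intro i
      induction i with
      | zero =>
        intro j _ hj x _
        rw [show j = k + 1 by omega, hk', LinearMap.zero_apply]
        exact R.zero_mem
      | succ i ih =>
        intro j hj hji
        exact hstep j hj (ih (j + 1) (by omega) (by omega))
    intro x hx
    simpa using hdown k 1 le_rfl (by omega) x hx
  -- `p = D x` is moved by `g` and `g'` along `e` only, hence it is fixed by `z`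
  have hp : ∀ (T : Module.End ℝ V), T e = e → (∀ x y, b (T x) (T y) = b x y) →
      (∀ k x, T ((D ^ k) x) = (D ^ k) (T x)) → T (D x) - D x ∈ R := by
    intro T hTe hT hTD
    have h1 := hTD 1 x
    rw [pow_one] at h1
    rw [h1, ← map_sub]
    exact hDWR _ (hVW T hTe hT x)
  obtain ⟨c, hc⟩ := Submodule.mem_span_singleton.1 (hp g hge hg hgD)
  obtain ⟨c', hc'⟩ := Submodule.mem_span_singleton.1 (hp g' hge' hg' hgD')
  have h1 : g (D x) = D x + c • e := by rw [hc]; abel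
  have h2 : g' (D x) = D x + c' • e := by rw [hc']; abel
  have h3 := hcomm (D x)
  rw [h1, h2, map_add, map_add, map_add, map_smul, map_smul, map_smul, hge, hge', hze, h1, h2,
    map_add, map_smul, hze] at h3
  rw [hDz]
  have : z (D x) = D x := by
    have h4 : z (D x) + c' • e + c • e = D x + c • e + c' • e := h3.symm
    have h5 : z (D x) + (c' • e + c • e) = D x + (c' • e + c • e) := by
      rw [← add_assoc, h4]; abel
    exact add_right_cancel h5
  rw [this, sub_self]

end Commutator

/-! ### The isotropic plane attached to an isotropic line -/

/-- An orthogonal representation of `SU(1, q)` on a nondegenerate real quadratic space without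
nonnegative subspaces of dimension three, which is continuous and nontrivial, and in which the
Eichler transformations act by unipotent maps. -/
structure OrthRep {q : ℕ} {V : Type*} [AddCommGroup V] [Module ℝ V] (b : LinearMap.BilinForm ℝ V)
    (R : SU 1 q →* Module.End ℝ V) : Prop where
  symm : ∀ x y, b x y = b y x
  nondeg : ∀ x, (∀ y, b x y = 0) → x = 0
  index : ∀ W : Submodule ℝ V, 3 ≤ Module.finrank ℝ W → ∃ x ∈ W, b x x < 0
  isom : ∀ A x y, b (R A x) (R A y) = b x y
  cont : ∀ x y, Continuous fun A => b (R A x) y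
  unip : ∀ {e f : CVec q}, HypPair e f → ∀ u s, herm q e u = 0 → herm q f u = 0 →
    IsNilpotent (R (eichler e u s) - 1)
  nontriv : ∃ A, R A ≠ 1

/-- The image of `log R(z)`, where `z` is a central element of the Heisenberg group fixing `e`;
the logarithm is `R(z) - 1`, since this has square zero. -/
noncomputable def isoPlane {q : ℕ} {V : Type*} [AddCommGroup V] [Module ℝ V]
    (R : SU 1 q →* Module.End ℝ V) (e : CVec q) : Submodule ℝ V :=
  LinearMap.range (R (eichler e 0 1) - 1)

namespace OrthRep

variable {q : ℕ} {V : Type*} [AddCommGroup V] [Module ℝ V]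
  {b : LinearMap.BilinForm ℝ V} {R : SU 1 q →* Module.End ℝ V} {e f : CVec q}

lemma mul_apply (R : SU 1 q →* Module.End ℝ V) (A B : SU 1 q) (x : V) :
    R (A * B) x = R A (R B x) := by
  rw [map_mul, Module.End.mul_apply]

lemma inv_apply (R : SU 1 q →* Module.End ℝ V) (A : SU 1 q) (x : V) : R A⁻¹ (R A x) = x := by
  rw [← mul_apply]; simp

lemma apply_inv (R : SU 1 q →* Module.End ℝ V) (A : SU 1 q) (x : V) : R A (R A⁻¹ x) = x := by
  rw [← mul_apply]; simp

lemma surjective (R : SU 1 q →* Module.End ℝ V) (A : SU 1 q) : Function.Surjective (R A) :=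
  fun x => ⟨R A⁻¹ x, apply_inv R A x⟩

lemma eichler_central_mul (he : herm q e e = 0) (s t : ℝ) :
    eichler e 0 s * eichler e 0 t = eichler e 0 (s + t) := by
  rw [eichler_mul he (by simp) (by simp)]; simp

lemma eichler_central_comm (he : herm q e e = 0) {u : CVec q} (hu : herm q e u = 0) (s t : ℝ) :
    eichler e 0 s * eichler e u t = eichler e u t * eichler e 0 s := by
  rw [eichler_mul he (by simp) hu, eichler_mul he hu (by simp)]; simp [add_comm]

lemma isom_inv (O : OrthRep b R) (A : SU 1 q) (x y : V) : b (R A x) y = b x (R A⁻¹ y) := by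
  rw [← O.isom A x, apply_inv]

lemma exists_log_ne_zero (O : OrthRep b R) (P : HypPair e f) :
    ∃ x, (R (eichler e 0 1) - 1) x ≠ 0 := by
  by_contra h
  push Not at h
  have hmem : eichler e 0 1 ∈ R.ker := by
    rw [MonoidHom.mem_ker]
    refine LinearMap.ext fun x => ?_
    exact sub_eq_zero.1 (h x)
  have htop := P.eq_top_of_normal R.ker hmem
  obtain ⟨A, hA⟩ := O.nontriv
  apply hA
  rw [← MonoidHom.mem_ker, htop]
  exact Subgroup.mem_top A

lemma mem_isoPlane_act (he : herm q e e = 0) (A : SU 1 q) {x : V} (hx : x ∈ isoPlane R e) :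
    R A x ∈ isoPlane R (act q A e) := by
  obtain ⟨y, rfl⟩ := hx
  refine ⟨R A y, ?_⟩
  have h := conj_eichler he (u := 0) (by simp) 1 A
  rw [map_zero] at h
  simp only [LinearMap.sub_apply, Module.End.one_apply, map_sub]
  rw [← h, mul_apply, mul_apply, inv_apply]

variable [FiniteDimensional ℝ V]

lemma central_sq (O : OrthRep b R) (P : HypPair e f) (s : ℝ) (x : V) :
    (R (eichler e 0 s) - 1) ((R (eichler e 0 s) - 1) x) = 0 := by
  obtain ⟨u, u', h1, h2, h3, h4, h⟩ := P.exists_comm s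
  refine sub_one_sq_of_commutator O.symm O.index (g := R (eichler e u 0)) (g' := R (eichler e u' 0))
    (O.isom _) (O.isom _) (O.isom _) (surjective R _) (surjective R _) (surjective R _)
    (O.unip P _ _ h1 h2) (O.unip P _ _ h3 h4) (O.unip P _ _ (by simp) (by simp)) ?_ ?_ ?_ x
  · intro y
    rw [← mul_apply, ← mul_apply, ← mul_apply, h, mul_assoc]
  · intro y
    rw [← mul_apply, ← mul_apply, eichler_central_comm P.ee h1]
  · intro y
    rw [← mul_apply, ← mul_apply, eichler_central_comm P.ee h3]

lemma central_mul_eq_zero (O : OrthRep b R) (P : HypPair e f) (s t : ℝ) :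
    (R (eichler e 0 s) - 1) * (R (eichler e 0 t) - 1) = 0 := by
  have hsq : ∀ s, (R (eichler e 0 s) - 1) * (R (eichler e 0 s) - 1) = 0 := fun s =>
    LinearMap.ext fun x => O.central_sq P s x
  have hc : (R (eichler e 0 s) - 1) * (R (eichler e 0 t) - 1) =
      (R (eichler e 0 t) - 1) * (R (eichler e 0 s) - 1) := by
    have : R (eichler e 0 s) * R (eichler e 0 t) = R (eichler e 0 t) * R (eichler e 0 s) := by
      rw [← map_mul, ← map_mul, eichler_central_comm P.ee (by simp)]
    rw [sub_mul, mul_sub, this]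
    noncomm_ring
  have h := hsq (s + t)
  have hX := hsq s
  have hY := hsq t
  have hst : R (eichler e 0 (s + t)) - 1 = (R (eichler e 0 s) - 1) + (R (eichler e 0 t) - 1) +
      (R (eichler e 0 s) - 1) * (R (eichler e 0 t) - 1) := by
    rw [← eichler_central_mul P.ee, map_mul]
    noncomm_ring
  rw [hst] at h
  set X := R (eichler e 0 s) - 1
  set Y := R (eichler e 0 t) - 1
  have hexp : (X + Y + X * Y) * (X + Y + X * Y) = (2 : ℝ) • (X * Y) := by
    have e1 : (X + Y + X * Y) * (X + Y + X * Y) = X * X + Y * Y + X * Y + Y * X +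
        (X * X) * Y + Y * X * Y + X * (Y * X) + X * (Y * Y) + X * (Y * X) * Y := by noncomm_ring
    rw [e1, ← hc, hX, hY, ← mul_assoc X X Y, hX, mul_assoc X Y Y, hY]
    simp [two_smul]
  rw [hexp] at h
  exact (smul_eq_zero.1 h).resolve_left (by norm_num)

/-- The central one-parameter group acts by `1 + s Y`, where `Y = R(eichler e 0 1) - 1`. -/
lemma central_apply (O : OrthRep b R) (P : HypPair e f) (s : ℝ) (x : V) :
    R (eichler e 0 s) x = x + s • (R (eichler e 0 1) - 1) x := by
  have hadd : ∀ s t y, b ((R (eichler e 0 (s + t)) - 1) x) y =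
      b ((R (eichler e 0 s) - 1) x) y + b ((R (eichler e 0 t) - 1) x) y := by
    intro s t y
    have hst : R (eichler e 0 (s + t)) - 1 = (R (eichler e 0 s) - 1) + (R (eichler e 0 t) - 1) +
        (R (eichler e 0 s) - 1) * (R (eichler e 0 t) - 1) := by
      rw [← eichler_central_mul P.ee, map_mul]
      noncomm_ring
    rw [hst, O.central_mul_eq_zero P, add_zero, LinearMap.add_apply, map_add, LinearMap.add_apply]
  have hlin : ∀ y, b ((R (eichler e 0 s) - 1) x) y = s * b ((R (eichler e 0 1) - 1) x) y := by
    intro y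
    let φ : ℝ →+ ℝ :=
      { toFun := fun s => b ((R (eichler e 0 s) - 1) x) y
        map_zero' := by simp [eichler_zero P.ee]
        map_add' := fun s t => hadd s t y }
    have hφ : Continuous φ := by
      change Continuous fun s => b ((R (eichler e 0 s) - 1) x) y
      have h1 : Continuous fun s : ℝ => eichler e 0 s := by
        have := continuous_eichler (u := 0) P.ee (by simp) (r := fun _ : ℝ => 0)
          continuous_const continuous_id
        simpa using this
      have h2 := (O.cont x y).comp h1
      simp only [LinearMap.sub_apply, map_sub, Module.End.one_apply]
      exact h2.sub continuous_const
    have := map_real_smul φ hφ s 1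
    simpa [φ] using this
  have h0 : (R (eichler e 0 s) - 1) x - s • (R (eichler e 0 1) - 1) x = 0 := by
    apply O.nondeg
    intro y
    rw [map_sub, LinearMap.sub_apply, hlin, map_smul, LinearMap.smul_apply, smul_eq_mul, sub_self]
  have h1 := sub_eq_zero.1 h0
  rw [LinearMap.sub_apply, Module.End.one_apply] at h1
  rw [← h1]; abel

lemma log_isotropic_and_skew (O : OrthRep b R) (P : HypPair e f) (x y : V) :
    b ((R (eichler e 0 1) - 1) x) ((R (eichler e 0 1) - 1) y) = 0 ∧
      b ((R (eichler e 0 1) - 1) x) y = - b x ((R (eichler e 0 1) - 1) y) := by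
  have h1 := O.isom (eichler e 0 1) x y
  have h2 := O.isom (eichler e 0 (-1)) x y
  rw [O.central_apply P, O.central_apply P 1 y] at h1
  rw [O.central_apply P, O.central_apply P (-1) y] at h2
  simp only [map_add, map_smul, LinearMap.add_apply, LinearMap.smul_apply, smul_eq_mul] at h1 h2
  constructor <;> linarith

lemma isoPlane_isotropic (O : OrthRep b R) (P : HypPair e f) :
    ∀ x ∈ isoPlane R e, ∀ y ∈ isoPlane R e, b x y = 0 := by
  rintro _ ⟨x, rfl⟩ _ ⟨y, rfl⟩
  exact (O.log_isotropic_and_skew P x y).1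

/-- The kernel of the logarithm is the orthogonal complement of its image. -/
lemma log_eq_zero_iff (O : OrthRep b R) (P : HypPair e f) (x : V) :
    (R (eichler e 0 1) - 1) x = 0 ↔ ∀ y ∈ isoPlane R e, b x y = 0 := by
  constructor
  · rintro h _ ⟨y, rfl⟩
    have := (O.log_isotropic_and_skew P x y).2
    rw [h] at this
    simp only [map_zero, LinearMap.zero_apply] at this
    linarith
  · intro h
    apply O.nondeg
    intro y
    rw [(O.log_isotropic_and_skew P x y).2, h _ ⟨y, rfl⟩, neg_zero]

lemma finrank_isoPlane (O : OrthRep b R) (P : HypPair e f) :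
    Module.finrank ℝ (isoPlane R e) = 2 := by
  apply le_antisymm
  · exact finrank_le_two_of_nonneg O.index fun x hx => (O.isoPlane_isotropic P x hx x hx).ge
  · by_contra hlt
    obtain ⟨x, hx⟩ := O.exists_log_ne_zero P
    set Y := R (eichler e 0 1) - 1 with hY
    have hle : Module.finrank ℝ (isoPlane R e) ≤ 1 := by omega
    -- a skew map of rank one vanishes
    obtain ⟨v, hv⟩ := (finrank_le_one_iff).1 hle
    have hv' : ∀ y, ∃ c : ℝ, Y y = c • (v : V) := by
      intro y
      obtain ⟨c, hc⟩ := hv ⟨Y y, ⟨y, rfl⟩⟩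
      exact ⟨c, (congrArg Subtype.val hc).symm⟩
    obtain ⟨c, hc⟩ := hv' x
    have hskew : ∀ x y, b (Y x) y = - b x (Y y) := fun x y => (O.log_isotropic_and_skew P x y).2
    have hxx : b (Y x) x = 0 := by
      have := hskew x x
      rw [O.symm x] at this
      linarith
    have hc0 : c ≠ 0 := by
      rintro rfl
      exact hx (by rw [hc, zero_smul])
    have hvx : b x (v : V) = 0 := by
      rw [hc, map_smul, LinearMap.smul_apply, smul_eq_mul] at hxx
      rw [O.symm]
      exact (mul_eq_zero.1 hxx).resolve_left hc0
    apply hx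
    apply O.nondeg
    intro y
    obtain ⟨c', hc'⟩ := hv' y
    rw [hskew, hc', map_smul, hvx, smul_zero, neg_zero]

lemma isoPlane_smul_le (O : OrthRep b R) (P : HypPair e f) (μ : ℂ) :
    isoPlane R (μ • e) ≤ isoPlane R e := by
  rintro _ ⟨y, rfl⟩
  rw [eichler_smul P.ee (by simp), smul_zero, LinearMap.sub_apply, O.central_apply P]
  simp only [Module.End.one_apply, add_sub_cancel_left]
  exact Submodule.smul_mem _ _ ⟨y, rfl⟩

lemma apply_mem_isoPlane (O : OrthRep b R) (P : HypPair e f) {A : SU 1 q} {μ : ℂ}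
    (hA : act q A e = μ • e) {x : V} (hx : x ∈ isoPlane R e) : R A x ∈ isoPlane R e := by
  have := mem_isoPlane_act P.ee A hx
  rw [hA] at this
  exact O.isoPlane_smul_le P μ this

/-- The Heisenberg group fixing `e` acts trivially on the isotropic plane of `e`. Its nilpotent
action on the plane takes place in the multiples of a single nilpotent map, and the rotation
`u ↦ i u` of the Heisenberg group would multiply it by a real square root of `-1`. -/
lemma eichler_zero_apply_of_mem (O : OrthRep b R) (P : HypPair e f) {u : CVec q}
    (h1 : herm q e u = 0) (h2 : herm q f u = 0) {x : V} (hx : x ∈ isoPlane R e) :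
    R (eichler e u 0) x = x := by
  by_cases hu0 : u = 0
  · rw [hu0, eichler_zero P.ee]; simp
  obtain ⟨A, hAe, hAf, hAu⟩ := P.exists_rotation h1 h2 hu0
  have h1' : herm q e (Complex.I • u) = 0 := by simp [h1]
  have h2' : herm q f (Complex.I • u) = 0 := by simp [h2]
  -- conjugation by `A` multiplies `u` by `i`
  have hconj : ∀ v, herm q e v = 0 → act q A v = -v →
      A * eichler e v 0 * A⁻¹ = eichler e (Complex.I • v) 0 := by
    intro v hv hAv
    rw [conj_eichler P.ee hv, hAe, hAv, eichler_smul P.ee (by simp [hv])]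
    simp
  have hconjR : ∀ v, herm q e v = 0 → act q A v = -v → ∀ x,
      R (eichler e (Complex.I • v) 0) (R A x) = R A (R (eichler e v 0) x) := by
    intro v hv hAv x
    rw [← hconj v hv hAv, mul_apply, mul_apply, inv_apply]
  have hAiu : act q A (Complex.I • u) = -(Complex.I • u) := by rw [map_smul, hAu, smul_neg]
  have hii : Complex.I • Complex.I • u = -u := by rw [smul_smul, Complex.I_mul_I]; simp
  set C := R (eichler e u 0) - 1 with hC
  set C' := R (eichler e (Complex.I • u) 0) - 1 with hC'
  set C'' := R (eichler e (-u) 0) - 1 with hC''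
  have hCmem : ∀ v s, herm q e v = 0 → ∀ x ∈ isoPlane R e,
      (R (eichler e v s) - 1) x ∈ isoPlane R e := by
    intro v s hv x hx
    exact Submodule.sub_mem _ (O.apply_mem_isoPlane P (μ := 1)
      (by rw [act_eichler_self P.ee hv, one_smul]) hx) hx
  have hCn : IsNilpotent C := O.unip P _ _ h1 h2
  have hCn' : IsNilpotent C' := O.unip P _ _ h1' h2'
  have hcentral : ∀ s, ∀ x ∈ isoPlane R e, R (eichler e 0 s) x = x := by
    intro s x hx
    rw [O.central_apply P, (O.log_eq_zero_iff P x).2 (O.isoPlane_isotropic P x hx)]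
    simp
  have hcomm : ∀ x ∈ isoPlane R e, C (C' x) = C' (C x) := by
    intro x hx
    have h := HypPair.eichler_comm P.ee h1 h1'
    have hg : R (eichler e u 0) (R (eichler e (Complex.I • u) 0) x) =
        R (eichler e (Complex.I • u) 0) (R (eichler e u 0) x) := by
      rw [← mul_apply, h, mul_apply, mul_apply, hcentral]
      exact O.apply_mem_isoPlane P (μ := 1) (by rw [act_eichler_self P.ee h1', one_smul])
        (O.apply_mem_isoPlane P (μ := 1) (by rw [act_eichler_self P.ee h1, one_smul]) hx)
    simp only [hC, hC', LinearMap.sub_apply, Module.End.one_apply, map_sub, hg]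
    abel
  have hrank := O.finrank_isoPlane P
  have hne : isoPlane R e ≠ ⊥ := by
    intro h; rw [h] at hrank; simp at hrank
  obtain ⟨x₀, hx₀, hx₀0⟩ := Submodule.exists_mem_ne_zero_of_ne_bot hne
  obtain ⟨y₁, hy₁, hy₁0, hCy₁⟩ := exists_mem_map_eq_zero hCn (hCmem u 0 h1) hx₀ hx₀0
  obtain ⟨y, ⟨hy, hCy⟩, hy0, hCy'⟩ := exists_mem_map_eq_zero hCn'
    (W := isoPlane R e ⊓ LinearMap.ker C) (by
      rintro w ⟨hw, hw'⟩
      refine ⟨hCmem _ 0 h1' w hw, LinearMap.mem_ker.2 ?_⟩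
      rw [hcomm w hw, LinearMap.mem_ker.1 hw', map_zero]) ⟨hy₁, LinearMap.mem_ker.2 hCy₁⟩ hy₁0
  have hCy : C y = 0 := LinearMap.mem_ker.1 hCy
  obtain ⟨x₁, hx₁, hx₁y⟩ : ∃ x₁ ∈ isoPlane R e, x₁ ∉ Submodule.span ℝ {y} := by
    by_contra h
    push Not at h
    have h3 := Submodule.finrank_mono (R := ℝ) (s := isoPlane R e) (t := Submodule.span ℝ {y}) h
    rw [finrank_span_singleton hy0] at h3
    omega
  have hform : ∀ T : Module.End ℝ V, IsNilpotent T → T y = 0 → T x₁ ∈ isoPlane R e →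
      ∃ β : ℝ, T x₁ = β • y := by
    intro T hT hTy hTx
    obtain ⟨α, β, h⟩ := exists_smul_add_smul_of_finrank_eq_two hrank hx₁ hy hy0 hx₁y hTx
    have h0 := coeff_eq_zero_of_isNilpotent hT hx₁y hTy h
    exact ⟨β, by rw [h, h0, zero_smul, zero_add]⟩
  obtain ⟨β, hβ⟩ := hform C hCn hCy (hCmem u 0 h1 _ hx₁)
  obtain ⟨β', hβ'⟩ := hform C' hCn' hCy' (hCmem _ 0 h1' _ hx₁)
  have hspan : ∀ x ∈ isoPlane R e, ∃ α γ : ℝ, x = α • x₁ + γ • y := fun x hx =>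
    exists_smul_add_smul_of_finrank_eq_two hrank hx₁ hy hy0 hx₁y hx
  by_cases hβ0 : β = 0
  · obtain ⟨α, γ, rfl⟩ := hspan x hx
    have : C (α • x₁ + γ • y) = 0 := by
      rw [map_add, map_smul, map_smul, hβ, hCy, hβ0]; simp
    exact sub_eq_zero.1 this
  exfalso
  set χ := β' / β with hχ
  have hC'C : ∀ x ∈ isoPlane R e, C' x = χ • C x := by
    intro x hx
    obtain ⟨α, γ, rfl⟩ := hspan x hx
    rw [map_add, map_smul, map_smul, map_add, map_smul, map_smul, hβ, hβ', hCy, hCy', smul_zero,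
      add_zero, add_zero, smul_smul, smul_smul, smul_smul]
    congr 1
    rw [hχ]
    field_simp
  have hAL : ∀ x ∈ isoPlane R e, R A x ∈ isoPlane R e := fun x hx =>
    O.apply_mem_isoPlane P hAe hx
  have hAL' : ∀ x ∈ isoPlane R e, R A⁻¹ x ∈ isoPlane R e := by
    intro x hx
    refine O.apply_mem_isoPlane P (μ := Complex.I⁻¹) ?_ hx
    apply act_inv_eq
    rw [map_smul, hAe, smul_smul]
    simp
  have hτ1 : ∀ x, C' (R A x) = R A (C x) := by
    intro x
    simp only [hC, hC', LinearMap.sub_apply, Module.End.one_apply, map_sub]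
    rw [hconjR u h1 hAu]
  have hτ2 : ∀ x, C'' (R A x) = R A (C' x) := by
    intro x
    simp only [hC', hC'', LinearMap.sub_apply, Module.End.one_apply, map_sub]
    rw [← hii, hconjR (Complex.I • u) h1' hAiu]
  have hC''C : ∀ x ∈ isoPlane R e, C'' x = (χ * χ) • C x := by
    intro x hx
    rw [← apply_inv R A x, hτ2, hC'C _ (hAL' x hx), map_smul, ← hτ1, apply_inv, hC'C x hx,
      smul_smul]
  have hCC : C (C x₁) = 0 := by rw [hβ, map_smul, hCy, smul_zero]
  have hinv : C x₁ + C'' x₁ + C (C'' x₁) = 0 := by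
    have h3 : eichler e u 0 * eichler e (-u) 0 = 1 := by
      have := eichler_inv P.ee h1 0
      rw [neg_zero] at this
      rw [← this, mul_inv_cancel]
    have h4 : R (eichler e u 0) (R (eichler e (-u) 0) x₁) = x₁ := by
      rw [← mul_apply, h3]; simp
    simp only [hC, hC'', LinearMap.sub_apply, Module.End.one_apply, map_sub, h4]
    abel
  rw [hC''C x₁ hx₁, map_smul, hCC, smul_zero, add_zero, hβ, smul_smul, ← add_smul] at hinv
  rcases smul_eq_zero.1 hinv with h | h
  · have h5 : β * (1 + χ * χ) = 0 := by linear_combination h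
    rcases mul_eq_zero.1 h5 with h6 | h6
    · exact hβ0 h6
    · nlinarith [mul_self_nonneg χ]
  · exact hy0 h

lemma eichler_apply_of_mem (O : OrthRep b R) (P : HypPair e f) {u : CVec q}
    (hu : herm q e u = 0) (s : ℝ) {x : V} (hx : x ∈ isoPlane R e) :
    R (eichler e u s) x = x := by
  obtain ⟨u', s', h1, h2, h⟩ := P.eichler_eq hu s
  have h0 : R (eichler e 0 s') x = x := by
    rw [O.central_apply P, (O.log_eq_zero_iff P x).2 (O.isoPlane_isotropic P x hx)]
    simp
  rw [h, mul_apply, h0, O.eichler_zero_apply_of_mem P h1 h2 hx]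

end OrthRep

/-! ### Opposite isotropic planes -/

namespace OrthRep

variable {q : ℕ} {V : Type*} [AddCommGroup V] [Module ℝ V] [FiniteDimensional ℝ V]
  {b : LinearMap.BilinForm ℝ V} {R : SU 1 q →* Module.End ℝ V} {e f : CVec q}

lemma mem_isoPlane_of_nonneg (O : OrthRep b R) (P : HypPair e f) {x : V}
    (hx : ∀ y ∈ isoPlane R e, b x y = 0) (hxx : 0 ≤ b x x) : x ∈ isoPlane R e :=
  mem_of_orthogonal_of_nonneg O.symm O.index (O.finrank_isoPlane P)
    (fun y hy => O.isoPlane_isotropic P y hy y hy) hx hxx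

/-- The isotropic planes of two opposite isotropic lines are in duality: a vector `x` in the
radical would be fixed by the whole group, which would then act on `x^⊥ / x` trivially, and
therefore would be commutative. -/
lemma eq_zero_of_orthogonal_opposite (O : OrthRep b R) (P : HypPair e f) {x : V}
    (hx : x ∈ isoPlane R e) (hxf : ∀ y ∈ isoPlane R f, b x y = 0) : x = 0 := by
  by_contra hx0
  have hxx : b x x = 0 := O.isoPlane_isotropic P x hx x hx
  have hxf' : x ∈ isoPlane R f := O.mem_isoPlane_of_nonneg P.symm hxf hxx.ge
  -- the group fixes `x`
  let H : Subgroup (SU 1 q) :=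
    { carrier := {A | ∀ y ∈ isoPlane R e ⊓ isoPlane R f, R A y = y}
      one_mem' := by intro y _; simp
      mul_mem' := by
        intro A B hA hB y hy
        rw [mul_apply, hB y hy, hA y hy]
      inv_mem' := by
        intro A hA y hy
        conv_lhs => rw [← hA y hy]
        rw [inv_apply] }
  have hH : H = ⊤ := by
    apply P.eq_top_of_eichler_mem
    · intro u hu _ y hy
      exact O.eichler_apply_of_mem P hu 0 hy.1
    · intro u _ hu y hy
      exact O.eichler_apply_of_mem P.symm hu 0 hy.2
    · intro σ hσe hσf A hA y hy
      have hσe' : act q σ⁻¹ e = (1 : ℂ) • e := by rw [one_smul]; exact act_inv_eq hσe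
      have hσf' : act q σ⁻¹ f = (1 : ℂ) • f := by rw [one_smul]; exact act_inv_eq hσf
      rw [mul_apply, mul_apply, hA _ ⟨O.apply_mem_isoPlane P hσe' hy.1,
        O.apply_mem_isoPlane P.symm hσf' hy.2⟩, apply_inv]
  have hfix : ∀ A, R A x = x := by
    intro A
    have hA : A ∈ H := by rw [hH]; exact Subgroup.mem_top A
    exact hA x ⟨hx, hxf'⟩
  have hinv : ∀ A y, b x (R A y) = b x y := by
    intro A y
    conv_lhs => rw [← hfix A]
    exact O.isom A x y
  have hfixs : ∀ A, ∀ r ∈ Submodule.span ℝ {x}, R A r = r := by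
    intro A r hr
    obtain ⟨c, rfl⟩ := Submodule.mem_span_singleton.1 hr
    rw [map_smul, hfix]
  -- the group acts trivially on `x^⊥ / x`
  let H' : Subgroup (SU 1 q) :=
    { carrier := {A | ∀ y, b x y = 0 → R A y - y ∈ Submodule.span ℝ {x}}
      one_mem' := by intro y _; simp
      mul_mem' := by
        intro A B hA hB y hy
        have h1 := hB y hy
        have h2 : R (A * B) y - y = R A (R B y - y) + (R A y - y) := by
          rw [mul_apply, map_sub]; abel
        rw [h2, hfixs A _ h1]
        exact Submodule.add_mem _ h1 (hA y hy)
      inv_mem' := by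
        intro A hA y hy
        have h1 := hA (R A⁻¹ y) (by rw [hinv, hy])
        rw [apply_inv] at h1
        rw [← neg_sub]
        exact Submodule.neg_mem _ h1 }
  have hH'n : H'.Normal := by
    constructor
    intro A hA B y hy
    have h1 := hA (R B⁻¹ y) (by rw [hinv, hy])
    have h2 : R (B * A * B⁻¹) y - y = R B (R A (R B⁻¹ y) - R B⁻¹ y) := by
      rw [mul_apply, mul_apply, map_sub, apply_inv]
    rw [h2, hfixs B _ h1]
    exact h1
  obtain ⟨x', hx'⟩ := hx
  have hH' : H' = ⊤ := by
    apply P.eq_top_of_normal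
    intro y hy
    change (R (eichler e 0 1) - 1) y ∈ _
    by_contra hYy
    apply hx0
    rw [← hx', O.log_eq_zero_iff P]
    intro v hv
    have hxL : x ∈ isoPlane R e := ⟨x', hx'⟩
    obtain ⟨α, β, h⟩ := exists_smul_add_smul_of_finrank_eq_two (O.finrank_isoPlane P)
      ⟨y, rfl⟩ hxL hx0 hYy hv
    have h1 : b x' ((R (eichler e 0 1) - 1) y) = 0 := by
      have := (O.log_isotropic_and_skew P x' y).2
      rw [hx', hy] at this
      linarith
    have h2 : b x' x = 0 := by
      have := (O.log_isotropic_and_skew P x' x').2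
      rw [hx', O.symm x] at this
      linarith
    rw [h, map_add, map_smul, map_smul, h1, h2]
    simp
  have hcomm : ∀ A B y, R A (R B y) = R B (R A y) := by
    intro A B y
    have htriv : ∀ C, ∀ y ∈ (⊤ : Submodule ℝ V), b x y = 0 →
        ∃ c : ℝ, R C y - y - c • x ∈ (⊥ : Submodule ℝ V) := by
      intro C y _ hy
      have hC : C ∈ H' := by rw [hH']; exact Subgroup.mem_top C
      obtain ⟨c, hc⟩ := Submodule.mem_span_singleton.1 (hC y hy)
      exact ⟨c, by rw [hc, sub_self]; exact Submodule.zero_mem _⟩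
    have := commute_mod_of_trivial O.symm (O.isom A) (O.isom B) (W := ⊤) (R := ⊥)
      (by simp) (by simp) (by simp) (by simp) (by simp) (e := x) (by simp [hfix])
      (by simp [hfix]) (htriv A) (htriv B) (y := y) trivial
    exact sub_eq_zero.1 ((Submodule.mem_bot ℝ).1 this)
  obtain ⟨u, u', _, _, _, _, h⟩ := P.exists_comm 1
  obtain ⟨y, hy⟩ := O.exists_log_ne_zero P
  apply hy
  have h1 : R (eichler e 0 1) = 1 := by
    refine LinearMap.ext fun y => ?_
    have h2 : eichler e 0 1 = eichler e u 0 * eichler e u' 0 *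
        (eichler e u' 0 * eichler e u 0)⁻¹ := by rw [h]; group
    rw [h2, mul_apply, mul_apply, hcomm (eichler e u 0), ← mul_apply, apply_inv]
    simp
  rw [h1]; simp

lemma eichler_sub_orthogonal (O : OrthRep b R) (P : HypPair e f) {u : CVec q}
    (hu : herm q e u = 0) (s : ℝ) (x : V) {y : V} (hy : y ∈ isoPlane R e) :
    b (R (eichler e u s) x - x) y = 0 := by
  rw [map_sub, LinearMap.sub_apply]
  conv_lhs => enter [1, 2]; rw [← O.eichler_apply_of_mem P hu s hy]
  rw [O.isom, sub_self]

lemma nonpos_of_orthogonal (O : OrthRep b R) (P : HypPair e f) {x : V}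
    (hx : ∀ y ∈ isoPlane R e, b x y = 0) : b x x ≤ 0 := by
  by_contra h
  push Not at h
  have hmem := O.mem_isoPlane_of_nonneg P hx h.le
  rw [hx x hmem] at h
  exact lt_irrefl _ h

lemma eichler_sub_mem (O : OrthRep b R) (P : HypPair e f) {u : CVec q} (h1 : herm q e u = 0)
    (h2 : herm q f u = 0) (s : ℝ) {x : V} (hx : ∀ y ∈ isoPlane R e, b x y = 0) :
    R (eichler e u s) x - x ∈ isoPlane R e := by
  have hW : ∀ x, x ∈ LinearMap.ker (R (eichler e 0 1) - 1) ↔ ∀ y ∈ isoPlane R e, b x y = 0 :=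
    fun x => LinearMap.mem_ker.trans (O.log_eq_zero_iff P x)
  refine sub_mem_of_unipotent O.symm (O.isom _) (O.unip P u s h1 h2)
    (W := LinearMap.ker (R (eichler e 0 1) - 1)) (fun x hx r hr => (hW x).1 hx r hr) ?_
    (fun x hx hxx => O.mem_isoPlane_of_nonneg P ((hW x).1 hx) hxx.ge) x ((hW x).2 hx)
  intro x hx
  rw [hW] at hx ⊢
  intro y hy
  rw [← O.eichler_apply_of_mem P h1 s hy, O.isom]
  exact hx y hy

/-- The matrix coefficient of a vector of the plane of `e` in terms of its displacement. -/
lemma coeff_eq_displacement (O : OrthRep b R) (P : HypPair e f) (A : SU 1 q) {v : V}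
    (hv : v ∈ isoPlane R e) : b v (R A v) = -(1 / 2) * b (R A v - v) (R A v - v) := by
  have h0 := O.isoPlane_isotropic P v hv v hv
  simp only [map_sub, LinearMap.sub_apply, O.isom, h0, O.symm (R A v) v]
  ring

/-- The displacement under the Heisenberg group of `f` is orthogonal to the plane of `f`, where the
form is nonpositive. -/
lemma coeff_opposite_nonneg (O : OrthRep b R) (P : HypPair e f) {u : CVec q}
    (h2 : herm q f u = 0) (s : ℝ) {v : V} (hv : v ∈ isoPlane R e) :
    0 ≤ b v (R (eichler f u s) v) := by
  rw [O.coeff_eq_displacement P _ hv]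
  have := O.nonpos_of_orthogonal P.symm (x := R (eichler f u s) v - v)
    (fun y hy => O.eichler_sub_orthogonal P.symm h2 s v hy)
  linarith

/-- The outer factors of the word `eichler_weyl` fix the vectors of the plane of `e`. -/
lemma coeff_reflection (O : OrthRep b R) (P : HypPair e f) {u : CVec q} (h1 : herm q e u = 0)
    (h2 : herm q f u = 0) (h3 : herm q u u = -2) {v w : V} (hv : v ∈ isoPlane R e)
    (hw : w ∈ isoPlane R e) :
    b v (R (biRefl (e - f) u (-1)) w) = b v (R (eichler f (-u) 0) w) := by
  rw [← P.eichler_weyl h1 h2 h3, mul_apply, mul_apply, O.eichler_apply_of_mem P h1 0 hw,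
    ← O.isom (eichler e u 0) v (R (eichler f (-u) 0) w), O.eichler_apply_of_mem P h1 0 hv]

/-- The form `b(v, R(ω_u) w)` on the plane of `e` is positive definite, where `ω_u` is the
reflection element attached to `u`. Since `ω_{iu} = ω_u`, a null vector `v` would be fixed by
the commutator of the transformations attached to `u` and `iu`. -/
lemma coeff_reflection_pos (O : OrthRep b R) (P : HypPair e f) {u : CVec q} (h1 : herm q e u = 0)
    (h2 : herm q f u = 0) (h3 : herm q u u = -2) {v : V} (hv : v ∈ isoPlane R e) (hv0 : v ≠ 0) :
    0 < b v (R (biRefl (e - f) u (-1)) v) := by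
  have hnonneg : 0 ≤ b v (R (biRefl (e - f) u (-1)) v) := by
    rw [O.coeff_reflection P h1 h2 h3 hv hv]
    exact O.coeff_opposite_nonneg P (by simp [h2]) 0 hv
  refine lt_of_le_of_ne hnonneg fun h0 => hv0 ?_
  have h1' : herm q e (Complex.I • u) = 0 := by simp [h1]
  have h2' : herm q f (Complex.I • u) = 0 := by simp [h2]
  have h3' : herm q (Complex.I • u) (Complex.I • u) = -2 := by
    simp only [map_smul, map_smulₛₗ, LinearMap.smul_apply, h3, Complex.conj_I, smul_eq_mul]
    linear_combination (2 : ℂ) * Complex.I_mul_I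
  have hsame : biRefl (e - f) (Complex.I • u) (-1) = biRefl (e - f) u (-1) := by
    have := biRefl_smul (c := e - f) (c' := u) (k := 1) (k' := Complex.I) one_ne_zero
      Complex.I_ne_zero (-1)
    rwa [one_smul] at this
  have hmem : ∀ w, herm q e w = 0 → herm q f w = 0 → b v (R (eichler f w 0) v) = 0 →
      R (eichler f w 0) v - v ∈ isoPlane R f := by
    intro w _ hfw hw
    apply O.mem_isoPlane_of_nonneg P.symm
      (fun y hy => O.eichler_sub_orthogonal P.symm hfw 0 v hy)
    rw [O.coeff_eq_displacement P _ hv] at hw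
    linarith
  have hm1 := hmem (-u) (by simp [h1]) (by simp [h2])
    (by rw [← O.coeff_reflection P h1 h2 h3 hv hv, ← h0])
  have hm2 := hmem (-(Complex.I • u)) (by rw [map_neg, h1', neg_zero])
    (by rw [map_neg, h2', neg_zero])
    (by rw [← O.coeff_reflection P h1' h2' h3' hv hv, hsame, ← h0])
  set g := eichler f (-u) 0 with hg
  set g' := eichler f (-(Complex.I • u)) 0 with hg'
  have hfu : herm q f (-u) = 0 := by simp [h2]
  have hfu' : herm q f (-(Complex.I • u)) = 0 := by rw [map_neg, h2', neg_zero]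
  have hcomm := HypPair.eichler_comm P.ff hfu hfu'
  rw [← hg, ← hg'] at hcomm
  have him : (herm q (-u) (-(Complex.I • u))).im = -2 := by
    simp [h3]
  rw [him] at hcomm
  have hgg : R g (R g' v) = R g' (R g v) := by
    have e1 : R g (R g' v) = R g (R g' v - v) + R g v := by rw [map_sub]; abel
    have e2 : R g' (R g v) = R g' (R g v - v) + R g' v := by rw [map_sub]; abel
    rw [e1, e2, O.eichler_apply_of_mem P.symm hfu 0 hm2,
      O.eichler_apply_of_mem P.symm hfu' 0 hm1]
    abel
  have hz : R (eichler f 0 (-2 * -2)) (R g (R g' v)) = R g (R g' v) := by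
    conv_rhs => rw [← mul_apply, hcomm, mul_apply, mul_apply, ← hgg]
  have hlog : (R (eichler f 0 1) - 1) (R g (R g' v)) = 0 := by
    rw [O.central_apply P.symm, add_eq_left, smul_eq_zero] at hz
    exact hz.resolve_left (by norm_num)
  have hdiff : R g (R g' v) = (R g' v - v) + (R g v - v) + v := by
    have e1 : R g (R g' v) = R g (R g' v - v) + R g v := by rw [map_sub]; abel
    rw [e1, O.eichler_apply_of_mem P.symm hfu 0 hm2]; abel
  apply O.eq_zero_of_orthogonal_opposite P hv
  rw [O.log_eq_zero_iff P.symm] at hlog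
  intro y hy
  have h4 := hlog y hy
  rw [hdiff, map_add, map_add, LinearMap.add_apply, LinearMap.add_apply,
    O.isoPlane_isotropic P.symm _ hm1 y hy, O.isoPlane_isotropic P.symm _ hm2 y hy] at h4
  linarith

/-- Quarter turns act trivially on the plane of `e`: they are selfadjoint and positive for the
positive definite form `b(v, R(ω_u) w)`, and of finite order. -/
lemma quarterTurn_apply_of_mem (O : OrthRep b R) (P : HypPair e f) {u₁ u₂ : CVec q}
    (h1 : herm q e u₁ = 0) (h1' : herm q f u₁ = 0) (h2 : herm q e u₂ = 0) (h2' : herm q f u₂ = 0)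
    (hn1 : herm q u₁ u₁ = -2) (hn2 : herm q u₂ u₂ = -2) (h12 : herm q u₁ u₂ = 0) {v : V}
    (hv : v ∈ isoPlane R e) : R (quarterTurn u₁ u₂) v = v := by
  obtain ⟨u, hu1, hu2, hu3, hj⟩ := P.quarterTurn_eq h1 h1' h2 h2' hn1 hn2 h12
  have hne : herm q u₁ u₁ ≠ 0 := by rw [hn1]; norm_num
  have hne2 : herm q u₂ u₂ ≠ 0 := by rw [hn2]; norm_num
  have hef : herm q (e - f) (e - f) ≠ 0 := by rw [P.herm_sub]; norm_num
  have hinvol : ∀ w, herm q e w = 0 → herm q f w = 0 → herm q w w = -2 →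
      biRefl (e - f) w (-1) * biRefl (e - f) w (-1) = 1 := by
    intro w hw1 hw2 hw3
    have hw0 : herm q w w ≠ 0 := by rw [hw3]; norm_num
    rw [biRefl_mul_self hef hw0 (by simp [hw1, hw2]) (by simp)]
    apply SU_ext
    intro x
    rw [act_biRefl hef hw0 (by simp)]
    simp [reflEnd_one]
  set ω := biRefl (e - f) u₁ (-1) with hω
  set ω' := biRefl (e - f) u (-1) with hω'
  set j := quarterTurn u₁ u₂ with hjdef
  have hωω := hinvol u₁ h1 h1' hn1
  have hωω' := hinvol u hu1 hu2 hu3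
  rw [← hω] at hωω
  rw [← hω'] at hωω'
  have hωj : ω * j = ω' := by rw [hj, ← mul_assoc, hωω, one_mul]
  have hinvω : ω⁻¹ = ω := inv_eq_of_mul_eq_one_left hωω
  have hinvω' : ω'⁻¹ = ω' := inv_eq_of_mul_eq_one_left hωω'
  have hjL : ∀ v ∈ isoPlane R e, R j v ∈ isoPlane R e := fun v hv =>
    O.apply_mem_isoPlane P (μ := 1) (by
      rw [one_smul]
      exact act_quarterTurn_of_orth hne (by rw [hn1, hn2]) h12 (herm_eq_zero_comm h1)
        (herm_eq_zero_comm h2)) hv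
  have hself : ∀ v w, b (R j v) (R ω w) = b v (R ω (R j w)) := by
    intro v w
    rw [← mul_apply R ω j, hωj, ← hinvω, ← O.isom_inv, ← mul_apply, hωj, O.isom_inv, hinvω']
  have hpos : ∀ v ∈ isoPlane R e, v ≠ 0 → 0 < b v (R ω v) := fun v hv hv0 =>
    O.coeff_reflection_pos P h1 h1' hn1 hv hv0
  have hpos' : ∀ v ∈ isoPlane R e, 0 ≤ b v (R ω (R j v)) := by
    intro v hv
    rw [← mul_apply, hωj]
    by_cases hv0 : v = 0
    · simp [hv0]
    · exact (O.coeff_reflection_pos P hu1 hu2 hu3 hv hv0).le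
  have hj4 : ∀ v, R j (R j (R j (R j v))) = v := by
    intro v
    have : j ^ 4 = 1 := quarterTurn_pow_four hne (by rw [hn1, hn2]) h12
    rw [← mul_apply, ← mul_apply, ← mul_apply,
      show j * j * j * j = j ^ 4 by simp only [pow_succ, pow_zero, one_mul], this]
    simp
  have hj2 : ∀ v ∈ isoPlane R e, R j (R j v) = v := by
    intro v hv
    by_contra hne
    set y := R j (R j v) - v with hy
    have hyL : y ∈ isoPlane R e := Submodule.sub_mem _ (hjL _ (hjL _ hv)) hv
    have hy0 : y ≠ 0 := sub_ne_zero.2 hne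
    have hjy : R j (R j y) = -y := by rw [hy, map_sub, map_sub, hj4]; abel
    have hjy0 : R j y ≠ 0 := by
      intro h
      rw [h, map_zero] at hjy
      exact hy0 (neg_eq_zero.1 hjy.symm)
    have h5 := hpos _ (hjL y hyL) hjy0
    rw [hself, hjy, map_neg, map_neg] at h5
    have h6 := hpos y hyL hy0
    linarith
  by_contra hne'
  set y := R j v - v with hy
  have hyL : y ∈ isoPlane R e := Submodule.sub_mem _ (hjL _ hv) hv
  have hy0 : y ≠ 0 := sub_ne_zero.2 hne'
  have hjy : R j y = -y := by rw [hy, map_sub, hj2 v hv]; abel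
  have h5 := hpos' y hyL
  rw [hjy, map_neg, map_neg] at h5
  have h6 := hpos y hyL hy0
  linarith

/-- The pointwise stabilizer of the pair acts trivially on the plane of `e`. -/
lemma stabilizer_apply_of_mem (O : OrthRep b R) (P : HypPair e f) {σ : SU 1 q}
    (hσe : act q σ e = e) (hσf : act q σ f = f) {v : V} (hv : v ∈ isoPlane R e) : R σ v = v := by
  let K : Subgroup (SU 1 q) :=
    { carrier := {A | ∀ y ∈ isoPlane R e, R A y = y}
      one_mem' := by intro y _; simp
      mul_mem' := by
        intro A B hA hB y hy
        rw [mul_apply, hB y hy, hA y hy]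
      inv_mem' := by
        intro A hA y hy
        conv_lhs => rw [← hA y hy]
        rw [inv_apply] }
  have : σ ∈ K := by
    refine P.stabilizer_le K ?_ ?_ hσe hσf
    · intro τ hτe hτf A hA y hy
      have hτe' : act q τ⁻¹ e = (1 : ℂ) • e := by rw [one_smul]; exact act_inv_eq hτe
      rw [mul_apply, mul_apply, hA _ (O.apply_mem_isoPlane P hτe' hy), apply_inv]
    · intro u₁ u₂ h1 h1' h2 h2' hn1 hn2 h12 y hy
      exact O.quarterTurn_apply_of_mem P h1 h1' h2 h2' hn1 hn2 h12 hy
  exact this v hv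

end OrthRep

/-! ### Matrix coefficients -/

namespace OrthRep

variable {q : ℕ} {V : Type*} [AddCommGroup V] [Module ℝ V] [FiniteDimensional ℝ V]
  {b : LinearMap.BilinForm ℝ V} {R : SU 1 q →* Module.End ℝ V} {e f : CVec q}

/-- Matrix coefficients of the plane of `e` depend only on the value `h(e, A e)`. -/
lemma coeff_congr (O : OrthRep b R) (P : HypPair e f) {A B : SU 1 q}
    (hAB : herm q e (act q A e) = herm q e (act q B e)) (h0 : herm q e (act q B e) ≠ 0) {v w : V}
    (hv : v ∈ isoPlane R e) (hw : w ∈ isoPlane R e) : b v (R A w) = b v (R B w) := by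
  obtain ⟨u, s, u', s', σ, hu, hu', h1, h2, h⟩ := P.exists_factorization hAB h0
  rw [h, mul_apply, O.stabilizer_apply_of_mem P h1 h2 hw, mul_apply,
    O.eichler_apply_of_mem P hu' s' hw, mul_apply, ← O.isom (eichler e u s) v (R B w),
    O.eichler_apply_of_mem P hu s hv]

lemma coeff_eq_zero (O : OrthRep b R) (P : HypPair e f) {A : SU 1 q}
    (hA : herm q e (act q A e) = 0) {v w : V} (hv : v ∈ isoPlane R e) (hw : w ∈ isoPlane R e) :
    b v (R A w) = 0 := by
  have h := P.eq_smul_of_isotropic (x := act q A e) (by rw [herm_act, P.ee]) hA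
  exact O.isoPlane_isotropic P v hv _ (O.apply_mem_isoPlane P h hw)

lemma coeff_eichler_pos (O : OrthRep b R) (P : HypPair e f) {u : CVec q} (h1 : herm q e u = 0)
    (h2 : herm q f u = 0) (h3 : herm q u u = -2) {v : V} (hv : v ∈ isoPlane R e) (hv0 : v ≠ 0) :
    0 < b v (R (eichler f u 0) v) := by
  have h4 := O.coeff_reflection P (u := -u) (by simp [h1]) (by simp [h2]) (by simp [h3]) hv hv
  rw [neg_neg] at h4
  rw [← h4]
  exact O.coeff_reflection_pos P (by simp [h1]) (by simp [h2]) (by simp [h3]) hv hv0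

lemma coeff_log_self (O : OrthRep b R) (P : HypPair e f) (v : V) :
    b v ((R (eichler e 0 1) - 1) v) = 0 := by
  have := (O.log_isotropic_and_skew P v v).2
  rw [O.symm _ v] at this
  linarith

/-- The element `-1` of the plane of `e` and `f` acts by `-1` on the isotropic plane of `e`. The
rotation `e ↦ i e`, `f ↦ i f`, whose square it is up to the stabilizer, has no real eigenvectors
there: for an eigenvector `x` the coefficients of `x` at a point with `h(e, A e) = 1` and at one
with `h(e, A e) = i` would be proportional, but the first is positive and the second is zero. -/
lemma centralInv_apply_of_mem (O : OrthRep b R) (P : HypPair e f) {v : V}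
    (hv : v ∈ isoPlane R e) : R (HypPair.centralInv e f) v = -v := by
  obtain ⟨u, h1, h2, h3⟩ := P.exists_norm
  have hu0 : u ≠ 0 := by
    rintro rfl
    simp at h3
  obtain ⟨A, hAe, hAf, -⟩ := P.exists_rotation h1 h2 hu0
  have hnoeig : ∀ x ∈ isoPlane R e, ∀ c : ℝ, c ≠ 0 → R A x = c • x → x = 0 := by
    intro x hx c hc hAx
    by_contra hx0
    have h4 : herm q e (act q (eichler f u 0 * A) e) = Complex.I := by
      rw [act_mul_apply, hAe, map_smul, map_smul, P.herm_act_eichler_opposite h1 h2, h3]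
      simp
    have h5 : herm q e (act q (eichler f 0 1) e) = Complex.I := by
      rw [P.herm_act_eichler_opposite (by simp) (by simp)]
      simp
    have h6 := O.coeff_congr P (h4.trans h5.symm) (by rw [h5]; exact Complex.I_ne_zero) hx hx
    rw [mul_apply, hAx, map_smul, map_smul, O.central_apply P.symm, one_smul, map_add,
      O.coeff_log_self P.symm, O.isoPlane_isotropic P x hx x hx, add_zero, smul_eq_mul] at h6
    have h7 := O.coeff_eichler_pos P h1 h2 h3 hx hx0
    rcases mul_eq_zero.1 h6 with h | h
    · exact hc h
    · exact h7.ne' h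
  set S := HypPair.centralInv e f with hS
  have hSe : act q S e = -e := P.act_centralInv_left
  have hSf : act q S f = -f := P.act_centralInv_right
  have hSL : ∀ x ∈ isoPlane R e, R S x ∈ isoPlane R e := fun x hx =>
    O.apply_mem_isoPlane P (μ := -1) (by rw [hSe, neg_one_smul]) hx
  have hAL : ∀ x ∈ isoPlane R e, R A x ∈ isoPlane R e := fun x hx =>
    O.apply_mem_isoPlane P hAe hx
  have hSS : ∀ x ∈ isoPlane R e, R S (R S x) = x := by
    intro x hx
    rw [← mul_apply]
    exact O.stabilizer_apply_of_mem P (by rw [act_mul_apply, hSe, map_neg, hSe, neg_neg])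
      (by rw [act_mul_apply, hSf, map_neg, hSf, neg_neg]) hx
  have hII : ∀ x : CVec q, Complex.I • Complex.I • x = -x := by
    intro x
    rw [smul_smul, Complex.I_mul_I, neg_one_smul]
  have hAA : ∀ x ∈ isoPlane R e, R A (R A x) = R S x := by
    intro x hx
    conv_lhs => rw [← hSS x hx]
    rw [← mul_apply, ← mul_apply]
    exact O.stabilizer_apply_of_mem P
      (by rw [act_mul_apply, act_mul_apply, hSe, map_neg, map_neg, hAe, map_smul, hAe, hII,
        neg_neg])
      (by rw [act_mul_apply, act_mul_apply, hSf, map_neg, map_neg, hAf, map_smul, hAf, hII,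
        neg_neg]) (hSL x hx)
  set x := v + R S v with hx
  have hxL : x ∈ isoPlane R e := Submodule.add_mem _ hv (hSL v hv)
  have hSx : R S x = x := by rw [hx, map_add, hSS v hv, add_comm]
  have hAx : x + R A x = 0 := by
    refine hnoeig _ (Submodule.add_mem _ hxL (hAL x hxL)) 1 one_ne_zero ?_
    rw [map_add, hAA x hxL, hSx, one_smul, add_comm]
  have hx0 : x = 0 := by
    refine hnoeig x hxL (-1) (by norm_num) ?_
    rw [neg_one_smul]
    exact eq_neg_of_add_eq_zero_right hAx
  exact eq_neg_of_add_eq_zero_right hx0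

/-- Modulo the plane of `f`, the map `u ↦ R (eichler f u 0) v` is additive, and the coefficient
is a quadratic form in `u`. -/
lemma coeff_eichler_smul (O : OrthRep b R) (P : HypPair e f) {u : CVec q} (h1 : herm q e u = 0)
    (h2 : herm q f u = 0) {v : V} (hv : v ∈ isoPlane R e) (t : ℝ) :
    b v (R (eichler f ((t : ℂ) • u) 0) v) = t ^ 2 * b v (R (eichler f u 0) v) := by
  have h1t : ∀ t : ℝ, herm q e ((t : ℂ) • u) = 0 := fun t => by rw [map_smul, h1, smul_zero]
  have h2t : ∀ t : ℝ, herm q f ((t : ℂ) • u) = 0 := fun t => by rw [map_smul, h2, smul_zero]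
  set D : ℝ → V := fun t => R (eichler f ((t : ℂ) • u) 0) v - v with hD
  have horth : ∀ t, ∀ y ∈ isoPlane R f, b (D t) y = 0 := fun t y hy =>
    O.eichler_sub_orthogonal P.symm (h2t t) 0 v hy
  have hlin : ∀ y, (∀ w ∈ isoPlane R f, b y w = 0) → ∀ t, b (D t) y = t * b (D 1) y := by
    intro y hy t
    have hadd : ∀ s t, b (D (s + t)) y = b (D s) y + b (D t) y := by
      intro s t
      have h3 : eichler f (((s + t : ℝ) : ℂ) • u) 0 =
          eichler f ((s : ℂ) • u) 0 * eichler f ((t : ℂ) • u) 0 := by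
        rw [eichler_mul P.ff (h2t s) (h2t t), ← add_smul, ← Complex.ofReal_add]
        congr 1
        simp only [map_smul, map_smulₛₗ, LinearMap.smul_apply, smul_eq_mul, Complex.conj_ofReal,
          Complex.im_ofReal_mul, herm_self_im]
        simp
      have h4 : D (s + t) = (R (eichler f ((s : ℂ) • u) 0) (D t) - D t) + D s + D t := by
        simp only [hD, h3, mul_apply, map_sub]
        abel
      have h5 := O.eichler_sub_mem P.symm (h2t s) (h1t s) 0 (horth t)
      rw [h4, map_add, map_add, LinearMap.add_apply, LinearMap.add_apply,
        O.symm (R (eichler f ((s : ℂ) • u) 0) (D t) - D t), hy _ h5, zero_add]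
    let φ : ℝ →+ ℝ :=
      { toFun := fun t => b (D t) y
        map_zero' := by
          have := hadd 0 0
          rw [add_zero] at this
          linarith
        map_add' := hadd }
    have hφ : Continuous φ := by
      change Continuous fun t => b (D t) y
      have h6 := (O.cont v y).comp (continuous_eichler P.ff h2
        (r := fun t : ℝ => (t : ℂ)) (s := fun _ => 0) Complex.continuous_ofReal continuous_const)
      simp only [hD, map_sub, LinearMap.sub_apply]
      exact h6.sub continuous_const
    have := map_real_smul φ hφ t 1
    simpa [φ] using this
  have hD1 : D 1 = R (eichler f u 0) v - v := by simp [hD]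
  rw [O.coeff_eq_displacement P (eichler f ((t : ℂ) • u) 0) hv,
    O.coeff_eq_displacement P (eichler f u 0) hv,
    ← hD1]
  change -(1 / 2) * b (D t) (D t) = _
  rw [hlin (D t) (horth t) t, O.symm (D 1), hlin (D 1) (horth 1) t]
  ring

/-- The matrix coefficient of a vector `v` of the plane of `e` agrees, up to a positive factor,
with that of the vector `e` of the standard representation. -/
lemma exists_coeff_eq (O : OrthRep b R) (P : HypPair e f) {v : V} (hv : v ∈ isoPlane R e)
    (hv0 : v ≠ 0) :
    ∃ c : ℝ, 0 < c ∧ ∀ A, b v (R A v) = c * (herm q e (act q A e)).re := by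
  obtain ⟨u, h1, h2, h3⟩ := P.exists_norm
  refine ⟨b v (R (eichler f u 0) v), O.coeff_eichler_pos P h1 h2 h3 hv hv0, ?_⟩
  have hpos : ∀ A, 0 ≤ (herm q e (act q A e)).re →
      b v (R A v) = b v (R (eichler f u 0) v) * (herm q e (act q A e)).re := by
    intro A hA
    by_cases h0 : herm q e (act q A e) = 0
    · rw [O.coeff_eq_zero P h0 hv hv, h0]; simp
    set z := herm q e (act q A e) with hz
    have h1' : herm q e ((Real.sqrt z.re : ℂ) • u) = 0 := by rw [map_smul, h1, smul_zero]
    have h2' : herm q f ((Real.sqrt z.re : ℂ) • u) = 0 := by rw [map_smul, h2, smul_zero]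
    have hsplit : eichler f ((Real.sqrt z.re : ℂ) • u) z.im =
        eichler f ((Real.sqrt z.re : ℂ) • u) 0 * eichler f 0 z.im := by
      rw [eichler_mul P.ff h2' (by simp)]; simp
    have hB : herm q e (act q (eichler f ((Real.sqrt z.re : ℂ) • u) z.im) e) = z := by
      rw [P.herm_act_eichler_opposite h1' h2']
      have hsq : ((Real.sqrt z.re : ℝ) : ℂ) * (Real.sqrt z.re : ℝ) = z.re := by
        rw [← Complex.ofReal_mul, Real.mul_self_sqrt hA]
      simp only [map_smul, map_smulₛₗ, LinearMap.smul_apply, smul_eq_mul, Complex.conj_ofReal]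
      rw [← mul_assoc, hsq, h3]
      conv_rhs => rw [← Complex.re_add_im z]
      ring
    rw [O.coeff_congr P (A := A) (by rw [hB, ← hz]) (by rwa [hB]) hv hv, hsplit, mul_apply,
      O.central_apply P.symm, map_add, map_smul, O.eichler_apply_of_mem P.symm h2' 0 ⟨v, rfl⟩,
      map_add, map_smul, O.coeff_log_self P.symm, smul_zero, add_zero,
      O.coeff_eichler_smul P h1 h2 hv, Real.sq_sqrt hA]
    ring
  intro A
  rcases le_total 0 (herm q e (act q A e)).re with hA | hA
  · exact hpos A hA
  · have h4 : herm q e (act q (A * HypPair.centralInv e f) e) = -herm q e (act q A e) := by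
      rw [act_mul_apply, P.act_centralInv_left, map_neg, map_neg]
    have h5 := hpos (A * HypPair.centralInv e f) (by rw [h4, Complex.neg_re]; linarith)
    rw [h4, mul_apply, O.centralInv_apply_of_mem P hv, map_neg, map_neg, Complex.neg_re] at h5
    linarith

end OrthRep

/-! ### The embedding of the standard representation -/

/-- The real part of the Hermitian form as a real bilinear form. -/
noncomputable def hermRe (q : ℕ) : LinearMap.BilinForm ℝ (CVec q) :=
  LinearMap.mk₂ ℝ (fun x y => (herm q x y).re)
    (by intro x y z; simp)
    (by intro c x y; rw [← Complex.coe_smul, map_smulₛₗ]; simp)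
    (by intro x y z; simp)
    (by intro c x y; rw [← Complex.coe_smul, map_smul]; simp)

lemma hermRe_apply {q : ℕ} (x y : CVec q) : hermRe q x y = (herm q x y).re := rfl

/-- The orthogonal complement of a positive definite plane is negative definite. -/
lemma eq_zero_of_orthogonal_of_pos {V : Type*} [AddCommGroup V] [Module ℝ V]
    [FiniteDimensional ℝ V] {b : LinearMap.BilinForm ℝ V} (hsymm : ∀ x y, b x y = b y x)
    (hidx : ∀ W : Submodule ℝ V, 3 ≤ Module.finrank ℝ W → ∃ x ∈ W, b x x < 0)
    {w₁ w₂ y : V} (h1 : 0 < b w₁ w₁) (h2 : 0 < b w₂ w₂) (h12 : b w₁ w₂ = 0)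
    (hy1 : b w₁ y = 0) (hy2 : b w₂ y = 0) (hy : 0 ≤ b y y) : y = 0 := by
  by_contra hy0
  have hw : w₁ ≠ 0 := by rintro rfl; simp at h1
  have hlt1 : Submodule.span ℝ {w₁} < Submodule.span ℝ {w₁, w₂} := by
    refine lt_of_le_of_ne (Submodule.span_mono (by simp)) fun h => ?_
    have hmem : w₂ ∈ Submodule.span ℝ {w₁} := by rw [h]; exact Submodule.subset_span (by simp)
    obtain ⟨c, rfl⟩ := Submodule.mem_span_singleton.1 hmem
    rw [map_smul, smul_eq_mul] at h12
    rcases mul_eq_zero.1 h12 with h | h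
    · simp [h] at h2
    · exact h1.ne' h
  have hlt2 : Submodule.span ℝ {w₁, w₂} < Submodule.span ℝ {w₁, w₂} ⊔ Submodule.span ℝ {y} := by
    refine lt_of_le_of_ne le_sup_left fun h => ?_
    have hmem : y ∈ Submodule.span ℝ {w₁, w₂} := by
      rw [h]; exact Submodule.mem_sup_right (Submodule.mem_span_singleton_self y)
    obtain ⟨α, β, rfl⟩ := Submodule.mem_span_pair.1 hmem
    simp only [map_add, map_smul, h12, hsymm w₂ w₁, smul_eq_mul, mul_zero, add_zero, zero_add]
      at hy1 hy2
    have hα := (mul_eq_zero.1 hy1).resolve_right h1.ne'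
    have hβ := (mul_eq_zero.1 hy2).resolve_right h2.ne'
    simp [hα, hβ] at hy0
  have hf1 := Submodule.finrank_lt_finrank_of_lt hlt1
  have hf2 := Submodule.finrank_lt_finrank_of_lt hlt2
  rw [finrank_span_singleton hw] at hf1
  have hle : Module.finrank ℝ
      (Submodule.span ℝ {w₁, w₂} ⊔ Submodule.span ℝ {y} : Submodule ℝ V) ≤ 2 := by
    apply finrank_le_two_of_nonneg hidx
    intro x hx
    obtain ⟨x1, hx1, x2, hx2, rfl⟩ := Submodule.mem_sup.1 hx
    obtain ⟨α, β, rfl⟩ := Submodule.mem_span_pair.1 hx1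
    obtain ⟨γ, rfl⟩ := Submodule.mem_span_singleton.1 hx2
    simp only [map_add, map_smul, LinearMap.add_apply, LinearMap.smul_apply, smul_eq_mul, h12,
      hsymm w₂ w₁, hy1, hy2, hsymm y w₁, hsymm y w₂, mul_zero, add_zero, zero_add]
    have e1 := mul_nonneg (mul_self_nonneg α) h1.le
    have e2 := mul_nonneg (mul_self_nonneg β) h2.le
    have e3 := mul_nonneg (mul_self_nonneg γ) hy
    nlinarith
  omega

namespace HypPair

variable {q : ℕ} {e f : CVec q}

/-- The orbit of an isotropic vector spans the standard representation over `ℝ`. -/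
lemma span_orbit (P : HypPair e f) :
    Submodule.span ℝ (Set.range fun A : SU 1 q => act q A e) = ⊤ := by
  set S := Submodule.span ℝ (Set.range fun A : SU 1 q => act q A e) with hS
  have hmem : ∀ A, act q A e ∈ S := fun A => Submodule.subset_span ⟨A, rfl⟩
  obtain ⟨u, h1, h2, h3⟩ := P.exists_norm
  have hu0 : u ≠ 0 := by
    rintro rfl
    simp at h3
  obtain ⟨A, hAe, hAf, -⟩ := P.exists_rotation h1 h2 hu0
  have he : e ∈ S := by simpa using hmem 1
  have hie : Complex.I • e ∈ S := by simpa [hAe] using hmem A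
  have hif : Complex.I • f ∈ S := by simpa [P.act_weyl_left] using hmem (weyl e f)
  have hf : f ∈ S := by
    have := hmem (weyl e f * A)
    rw [act_mul_apply, hAe, map_smul, P.act_weyl_left, smul_smul, Complex.I_mul_I,
      neg_one_smul] at this
    simpa using S.neg_mem this
  have hc : ∀ (z : ℂ) (x : CVec q), x ∈ S → Complex.I • x ∈ S → z • x ∈ S := by
    intro z x hx hix
    have : z • x = z.re • x + z.im • Complex.I • x := by
      conv_lhs => rw [← Complex.re_add_im z]
      rw [add_smul, mul_smul, Complex.coe_smul, Complex.coe_smul]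
    rw [this]
    exact S.add_mem (S.smul_mem _ hx) (S.smul_mem _ hix)
  rw [eq_top_iff]
  intro x _
  obtain ⟨y, hy1, hy2, hy⟩ := P.decomp x
  have hyS : y ∈ S := by
    have h4 := hmem (eichler f y 0)
    rw [act_eichler P.ff hy2, P.fe, herm_eq_zero_comm hy1] at h4
    have h5 := S.sub_mem (S.sub_mem h4 he) (hc ((Complex.I * (0 : ℝ) - herm q y y / 2) * 1) f hf
      hif)
    convert h5 using 1
    module
  rw [hy]
  exact S.add_mem (S.add_mem (hc _ e he hie) (hc _ f hf hif)) hyS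

end HypPair

namespace OrthRep

variable {q : ℕ} {V : Type*} [AddCommGroup V] [Module ℝ V] [FiniteDimensional ℝ V]
  {b : LinearMap.BilinForm ℝ V} {R : SU 1 q →* Module.End ℝ V} {e f : CVec q}

lemma exists_coeff_eq_herm (O : OrthRep b R) (P : HypPair e f) :
    ∃ v, ∀ A, b v (R A v) = (herm q e (act q A e)).re := by
  have hne : isoPlane R e ≠ ⊥ := by
    intro h
    have := O.finrank_isoPlane P
    rw [h] at this
    simp at this
  obtain ⟨v, hv, hv0⟩ := Submodule.exists_mem_ne_zero_of_ne_bot hne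
  obtain ⟨c, hc, h⟩ := O.exists_coeff_eq P hv hv0
  refine ⟨(Real.sqrt c)⁻¹ • v, fun A => ?_⟩
  rw [map_smul, map_smul, map_smul, LinearMap.smul_apply, h, smul_eq_mul, smul_eq_mul]
  have hs := Real.mul_self_sqrt hc.le
  have hs0 : Real.sqrt c ≠ 0 := (Real.sqrt_pos.2 hc).ne'
  field_simp
  linear_combination (-(herm q e (act q A e)).re) * hs

/-- A vector with the same matrix coefficient as a vector generating the standard representation
defines an equivariant isometric embedding, as in the Gelfand–Naimark–Segal construction. The
linear relations among the translates carry over because the vectors orthogonal to a positive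
definite plane have negative square. -/
lemma exists_embedding (O : OrthRep b R) (P : HypPair e f) :
    ∃ φ : CVec q →ₗ[ℝ] V, (∀ x y, b (φ x) (φ y) = (herm q x y).re) ∧
      ∀ A x, φ (act q A x) = R A (φ x) := by
  obtain ⟨v, hv⟩ := O.exists_coeff_eq_herm P
  let Φ : (SU 1 q →₀ ℝ) →ₗ[ℝ] CVec q := Finsupp.linearCombination ℝ fun A => act q A e
  let Ψ : (SU 1 q →₀ ℝ) →ₗ[ℝ] V := Finsupp.linearCombination ℝ fun A => R A v
  have hΦ : LinearMap.range Φ = ⊤ := by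
    rw [Finsupp.range_linearCombination]
    exact P.span_orbit
  have hbase : ∀ A B, b (R A v) (R B v) = hermRe q (act q A e) (act q B e) := by
    intro A B
    rw [O.isom_inv, ← mul_apply, hv, hermRe_apply, act_mul_apply, ← herm_act A e, act_act_inv]
  have hiso : ∀ ξ η, b (Ψ ξ) (Ψ η) = hermRe q (Φ ξ) (Φ η) := by
    intro ξ η
    induction ξ using Finsupp.induction_linear with
    | zero => simp
    | add ξ ξ' h h' => rw [map_add, map_add, map_add, map_add, LinearMap.add_apply,
        LinearMap.add_apply, h, h']
    | single A s =>
      induction η using Finsupp.induction_linear with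
      | zero => simp
      | add η η' h h' => rw [map_add, map_add, map_add, map_add, h, h']
      | single B t =>
        simp only [Φ, Ψ, Finsupp.linearCombination_single, map_smul, LinearMap.smul_apply, hbase]
  obtain ⟨s, hs⟩ := Φ.exists_rightInverse_of_surjective hΦ
  have hs' : ∀ x, Φ (s x) = x := fun x => LinearMap.congr_fun hs x
  have hker : ∀ ξ, Φ ξ = 0 → Ψ ξ = 0 := by
    intro ξ hξ
    have h0 : ∀ η, b (Ψ η) (Ψ ξ) = 0 := by
      intro η
      rw [hiso, hξ, map_zero]
    refine eq_zero_of_orthogonal_of_pos O.symm O.index (w₁ := Ψ (s (e + f)))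
      (w₂ := Ψ (s (Complex.I • (e + f)))) ?_ ?_ ?_ (h0 _) (h0 _) (h0 _).ge
    · rw [hiso, hs', hermRe_apply, P.herm_add]; norm_num
    · rw [hiso, hs', hermRe_apply, map_smul, map_smulₛₗ, LinearMap.smul_apply, P.herm_add]
      simp
    · rw [hiso, hs', hs', hermRe_apply, map_smul, P.herm_add]
      simp
  have hΨ : ∀ ξ, Ψ (s (Φ ξ)) = Ψ ξ := by
    intro ξ
    rw [← sub_eq_zero, ← map_sub]
    apply hker
    rw [map_sub, hs', sub_self]
  refine ⟨Ψ ∘ₗ s, ?_, ?_⟩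
  · intro x y
    rw [LinearMap.comp_apply, LinearMap.comp_apply, hiso, hs', hs', hermRe_apply]
  · intro A x
    have hmapΦ : ∀ ξ, Φ (Finsupp.mapDomain (A * ·) ξ) = act q A (Φ ξ) := by
      intro ξ
      induction ξ using Finsupp.induction_linear with
      | zero => simp
      | add ξ ξ' h h' => rw [Finsupp.mapDomain_add, map_add, map_add, map_add, h, h']
      | single B t =>
        simp only [Φ, Finsupp.mapDomain_single, Finsupp.linearCombination_single]
        rw [act_mul_apply, ← Complex.coe_smul, ← Complex.coe_smul, map_smul]
    have hmapΨ : ∀ ξ, Ψ (Finsupp.mapDomain (A * ·) ξ) = R A (Ψ ξ) := by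
      intro ξ
      induction ξ using Finsupp.induction_linear with
      | zero => simp
      | add ξ ξ' h h' => rw [Finsupp.mapDomain_add, map_add, map_add, map_add, h, h']
      | single B t =>
        simp only [Ψ, Finsupp.mapDomain_single, Finsupp.linearCombination_single]
        rw [mul_apply, map_smul]
    rw [LinearMap.comp_apply, LinearMap.comp_apply, ← hmapΨ,
      ← hΨ (Finsupp.mapDomain (A * ·) (s x)), hmapΦ, hs']

/-- The orthogonal complement of an embedded standard representation is negative definite, so the
unipotent elements, and hence the whole group, act trivially on it. -/
lemma apply_eq_of_orthogonal (O : OrthRep b R) (P : HypPair e f) {φ : CVec q →ₗ[ℝ] V}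
    (hφ : ∀ x y, b (φ x) (φ y) = (herm q x y).re) (hequiv : ∀ A x, φ (act q A x) = R A (φ x))
    (A : SU 1 q) {w : V} (hw : ∀ x, b w (φ x) = 0) : R A w = w := by
  let W : Submodule ℝ V :=
    { carrier := {w | ∀ x, b w (φ x) = 0}
      add_mem' := by
        intro w w' h h' x
        rw [map_add, LinearMap.add_apply, h x, h' x, add_zero]
      zero_mem' := by intro x; simp
      smul_mem' := by
        intro c w h x
        rw [map_smul, LinearMap.smul_apply, h x, smul_zero] }
  have hWinv : ∀ A, ∀ w ∈ W, R A w ∈ W := by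
    intro A w hw x
    rw [O.isom_inv, ← hequiv]
    exact hw _
  have hdef : ∀ w ∈ W, b w w = 0 → w ∈ (⊥ : Submodule ℝ V) := by
    intro w hw hww
    rw [Submodule.mem_bot]
    refine eq_zero_of_orthogonal_of_pos O.symm O.index (w₁ := φ (e + f))
      (w₂ := φ (Complex.I • (e + f))) ?_ ?_ ?_ (by rw [O.symm]; exact hw _)
      (by rw [O.symm]; exact hw _) hww.ge
    · rw [hφ, P.herm_add]; norm_num
    · rw [hφ, map_smul, map_smulₛₗ, LinearMap.smul_apply, P.herm_add]
      simp
    · rw [hφ, map_smul, P.herm_add]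
      simp
  let H : Subgroup (SU 1 q) :=
    { carrier := {A | ∀ y ∈ W, R A y = y}
      one_mem' := by intro y _; simp
      mul_mem' := by
        intro A B hA hB y hy
        rw [mul_apply, hB y hy, hA y hy]
      inv_mem' := by
        intro A hA y hy
        conv_lhs => rw [← hA y hy]
        rw [inv_apply] }
  have hunip : ∀ A, IsNilpotent (R A - 1) → A ∈ H := by
    intro A hA y hy
    have := sub_mem_of_unipotent O.symm (O.isom A) hA (W := W) (R := ⊥)
      (by intro x _ r hr; rw [(Submodule.mem_bot ℝ).1 hr, map_zero]) (hWinv A) hdef y hy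
    exact sub_eq_zero.1 ((Submodule.mem_bot ℝ).1 this)
  have hH : H = ⊤ := by
    apply P.eq_top_of_eichler_mem
    · exact fun u h1 h2 => hunip _ (O.unip P u 0 h1 h2)
    · exact fun u h1 h2 => hunip _ (O.unip P.symm u 0 h2 h1)
    · intro σ _ _ A hA y hy
      rw [mul_apply, mul_apply, hA _ (hWinv _ _ hy), apply_inv]
  have hA : A ∈ H := by rw [hH]; exact Subgroup.mem_top A
  exact hA w hw

end OrthRep

/-! ### The orthogonal representation defined by a homomorphism to `SO(2, n)` -/

/-- `realForm 2 n` as a bilinear form. -/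
noncomputable def realBilin (n : ℕ) : LinearMap.BilinForm ℝ (Fin 2 ⊕ Fin n → ℝ) :=
  LinearMap.mk₂ ℝ (realForm 2 n)
    (by intro x y z; simp [realForm, add_dotProduct])
    (by intro c x y; simp [realForm, smul_dotProduct])
    (by intro x y z; simp [realForm, mulVec_add, dotProduct_add])
    (by intro c x y; simp [realForm, mulVec_smul, dotProduct_smul])

lemma realBilin_apply (n : ℕ) (x y : Fin 2 ⊕ Fin n → ℝ) : realBilin n x y = realForm 2 n x y := rfl

lemma realBilin_eq_sum (n : ℕ) (x y : Fin 2 ⊕ Fin n → ℝ) :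
    realBilin n x y = ∑ i, x (Sum.inl i) * y (Sum.inl i) - ∑ j, x (Sum.inr j) * y (Sum.inr j) := by
  simp [realBilin_apply, realForm, LieAlgebra.Orthogonal.indefiniteDiagonal, dotProduct,
    mulVec_diagonal, sub_eq_add_neg]

lemma realBilin_symm (n : ℕ) (x y : Fin 2 ⊕ Fin n → ℝ) : realBilin n x y = realBilin n y x := by
  simp only [realBilin_eq_sum, mul_comm]

lemma realBilin_nondeg (n : ℕ) (x : Fin 2 ⊕ Fin n → ℝ) (h : ∀ y, realBilin n x y = 0) : x = 0 := by
  funext i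
  have := h (Pi.single i 1)
  rcases i with i | i <;> simpa [realBilin_eq_sum, Pi.single_apply] using this

/-- The kernel of the projection to the positive coordinates meets a subspace of dimension at
least three, and the form is negative on it. -/
lemma exists_realBilin_neg (n : ℕ) (W : Submodule ℝ (Fin 2 ⊕ Fin n → ℝ))
    (hW : 3 ≤ Module.finrank ℝ W) : ∃ x ∈ W, realBilin n x x < 0 := by
  let p : W →ₗ[ℝ] (Fin 2 → ℝ) := (LinearMap.funLeft ℝ ℝ Sum.inl) ∘ₗ W.subtype
  have hp : LinearMap.ker p ≠ ⊥ := LinearMap.ker_ne_bot_of_finrank_lt (by simpa using by omega)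
  obtain ⟨x, hx, hx0⟩ := Submodule.exists_mem_ne_zero_of_ne_bot hp
  have hx1 : ∀ i, x.1 (Sum.inl i) = 0 := fun i => congrFun (LinearMap.mem_ker.1 hx) i
  refine ⟨x.1, x.2, ?_⟩
  rw [realBilin_eq_sum]
  simp only [hx1, mul_zero, Finset.sum_const_zero, zero_sub, neg_lt_zero]
  obtain ⟨j, hj⟩ : ∃ j, x.1 (Sum.inr j) ≠ 0 := by
    by_contra hcon
    push Not at hcon
    apply hx0
    ext i
    rcases i with i | i
    · exact hx1 i
    · exact hcon i
  exact Finset.sum_pos' (fun i _ => mul_self_nonneg _) ⟨j, Finset.mem_univ _, mul_self_pos.2 hj⟩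

/-- The representation on `ℝ^(2+n)` defined by a homomorphism to `SO(2, n)`. -/
noncomputable def toRep {q n : ℕ} (ρ : SU 1 q →* SO 2 n) :
    SU 1 q →* Module.End ℝ (Fin 2 ⊕ Fin n → ℝ) where
  toFun A := Matrix.toLin' (ρ A).1.1
  map_one' := by
    rw [map_one]
    change Matrix.toLin' (1 : Matrix _ _ ℝ) = 1
    rw [Matrix.toLin'_one]; rfl
  map_mul' A B := by
    rw [map_mul]
    change Matrix.toLin' ((ρ A).1.1 * (ρ B).1.1) = _
    rw [Matrix.toLin'_mul]; rfl

lemma toRep_apply {q n : ℕ} (ρ : SU 1 q →* SO 2 n) (A : SU 1 q) (x : Fin 2 ⊕ Fin n → ℝ) :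
    toRep ρ A x = (ρ A).1.1 *ᵥ x := rfl

lemma realBilin_toRep {q n : ℕ} (ρ : SU 1 q →* SO 2 n) (A : SU 1 q) (x y : Fin 2 ⊕ Fin n → ℝ) :
    realBilin n (toRep ρ A x) (toRep ρ A y) = realBilin n x y := by
  have h : (ρ A).1.1ᵀ * sigMatrix ℝ 2 n * (ρ A).1.1 = sigMatrix ℝ 2 n := (ρ A).2
  simp only [realBilin_apply, realForm, toRep_apply]
  conv_rhs => rw [← h]
  rw [← vecMul_transpose, ← dotProduct_mulVec, mulVec_mulVec, mulVec_mulVec, Matrix.mul_assoc]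

lemma continuous_coe_comp {q n : ℕ} {ρ : SU 1 q →* SO 2 n} (hρ : Continuous ρ) :
    Continuous fun A => (ρ A).1.1 := by
  have h : Continuous fun A => (ρ A).1 := continuous_subtype_val.comp hρ
  exact continuous_subtype_val.comp h

/-- Boosts contract an Eichler transformation to the identity by conjugation. The characteristic
polynomial is constant along the contraction, so by continuity it is that of the identity. -/
lemma isNilpotent_toRep_eichler {q n : ℕ} {ρ : SU 1 q →* SO 2 n} (hρ : Continuous ρ)
    {e f : CVec q} (P : HypPair e f) (u : CVec q) (s : ℝ) (h1 : herm q e u = 0)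
    (h2 : herm q f u = 0) : IsNilpotent (toRep ρ (eichler e u s) - 1) := by
  let M : ℝ → Matrix (Fin 2 ⊕ Fin n) (Fin 2 ⊕ Fin n) ℝ :=
    fun t => (ρ (eichler e ((t : ℂ) • u) (t ^ 2 * s))).1.1
  have hM : Continuous M := (continuous_coe_comp hρ).comp
    (continuous_eichler P.ee h1 Complex.continuous_ofReal
      ((continuous_pow 2).mul continuous_const))
  have hM0 : M 0 = 1 := by
    simp only [M, Complex.ofReal_zero, zero_smul]
    rw [zero_pow two_ne_zero, zero_mul, eichler_zero P.ee, map_one]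
    rfl
  have hM1 : M 1 = (ρ (eichler e u s)).1.1 := by simp [M]
  have hconj : ∀ t, 0 < t → (M t).charpoly = (M 1).charpoly := by
    intro t ht
    obtain ⟨A, hA, -, hAu⟩ := P.exists_boost ht
    have h3 : A * eichler e u s * A⁻¹ = eichler e ((t : ℂ) • u) (t ^ 2 * s) := by
      rw [conj_eichler P.ee h1, hA, hAu u h1 h2, eichler_smul P.ee h1, Complex.conj_ofReal,
        Complex.normSq_ofReal, sq]
    have h4 : M t = (ρ A).1.1 * M 1 * (ρ A⁻¹).1.1 := by
      rw [hM1]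
      simp only [M]
      rw [← h3, map_mul, map_mul]
      rfl
    have h5 : (ρ A⁻¹).1.1 * (ρ A).1.1 = 1 := by
      change ((ρ A⁻¹ * ρ A).1.1 : Matrix _ _ ℝ) = 1
      rw [← map_mul, inv_mul_cancel, map_one]
      rfl
    rw [h4, Matrix.charpoly_mul_comm, ← Matrix.mul_assoc, h5, Matrix.one_mul]
  have hchar : (M 1).charpoly = (1 : Matrix (Fin 2 ⊕ Fin n) (Fin 2 ⊕ Fin n) ℝ).charpoly := by
    refine Polynomial.funext fun x => ?_
    have hcont : Continuous fun t => (M t).charpoly.eval x := by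
      simp only [Matrix.eval_charpoly]
      exact (continuous_const.sub hM).matrix_det
    have hlim := (hcont.tendsto 0).mono_left (nhdsWithin_le_nhds (s := Set.Ioi 0))
    rw [hM0] at hlim
    refine tendsto_nhds_unique (tendsto_const_nhds.congr' ?_) hlim
    filter_upwards [self_mem_nhdsWithin] with t ht
    rw [hconj t ht]
  have hCH := Matrix.aeval_self_charpoly (M 1)
  rw [hchar, Matrix.charpoly_one, map_pow, map_sub, Polynomial.aeval_X, map_one] at hCH
  have h6 : toRep ρ (eichler e u s) - 1 = Matrix.toLinAlgEquiv' (M 1 - 1) := by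
    rw [map_sub, map_one, hM1]
    rfl
  exact ⟨_, by rw [h6, ← map_pow, hCH, map_zero]⟩

lemma orthRep_toRep {q n : ℕ} {ρ : SU 1 q →* SO 2 n} (hρ : Continuous ρ)
    (hnontriv : ∃ A : SU 1 q, ρ A ≠ 1) : OrthRep (realBilin n) (toRep ρ) where
  symm := realBilin_symm n
  nondeg := realBilin_nondeg n
  index := exists_realBilin_neg n
  isom := realBilin_toRep ρ
  cont x y := by
    have hm := continuous_coe_comp hρ
    simp only [realBilin_apply, realForm, toRep_apply]
    fun_prop
  unip := isNilpotent_toRep_eichler hρ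
  nontriv := by
    obtain ⟨A, hA⟩ := hnontriv
    refine ⟨A, fun h => hA ?_⟩
    apply Subtype.ext
    apply Subtype.ext
    exact Matrix.toLin'.injective (h.trans (Matrix.toLin'_one).symm)

/-- The hyperbolic pair `(ε₀ + ε₁, (ε₀ - ε₁) / 2)` in the standard basis of `ℂ^(1+q)`. -/
lemma exists_hypPair {q : ℕ} (hq : 2 ≤ q) : ∃ e f : CVec q, HypPair e f := by
  obtain ⟨m, rfl⟩ : ∃ m, q = m + 2 := ⟨q - 2, by omega⟩
  refine ⟨Pi.single (Sum.inl 0) 1 + Pi.single (Sum.inr 0) 1,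
    (1 / 2 : ℂ) • (Pi.single (Sum.inl 0) 1 - Pi.single (Sum.inr 0) 1), ?_, ?_, ?_, ?_, ?_⟩
  · simp [herm_eq_sum, Pi.single_apply]
  · simp [herm_eq_sum, Pi.single_apply]
  · simp [herm_eq_sum, Pi.single_apply]; norm_num
  · intro x h1 h2 hx
    have h1' : x (Sum.inl 0) + -x (Sum.inr 0) = 0 := by
      simpa [herm_eq_sum, Pi.single_apply] using h1
    have h2' : x (Sum.inl 0) + x (Sum.inr 0) = 0 := by
      simpa [herm_eq_sum, Pi.single_apply] using h2
    have h0 : x (Sum.inl 0) = 0 := by linear_combination (h1' + h2') / 2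
    obtain ⟨j, hj⟩ : ∃ j, x (Sum.inr j) ≠ 0 := by
      by_contra hcon
      push Not at hcon
      apply hx
      funext i
      rcases i with i | i
      · rw [Subsingleton.elim i 0, h0]; rfl
      · exact hcon i
    have h4 : (herm (m + 2) x x).re = -∑ i, Complex.normSq (x (Sum.inr i)) := by
      rw [herm_eq_sum, h0]
      simp [Complex.normSq_apply]
    rw [h4, neg_lt_zero]
    exact Finset.sum_pos' (fun i _ => Complex.normSq_nonneg _)
      ⟨j, Finset.mem_univ _, Complex.normSq_pos.2 hj⟩
  · refine ⟨Pi.single (Sum.inr 1) 1, ?_, ?_, ?_⟩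
    · intro h
      simpa using congrFun h (Sum.inr 1)
    · simp [herm_eq_sum, Pi.single_apply]
    · simp [herm_eq_sum, Pi.single_apply]

theorem mainTheorem7 (q n : ℕ) (hq : 2 ≤ q) (ρ : SU 1 q →* SO 2 n) (hρ : Continuous ρ)
    (hnontriv : ∃ A : SU 1 q, ρ A ≠ 1) :
    ComesFromStandard ρ := by
  obtain ⟨e, f, P⟩ := exists_hypPair hq
  have O := orthRep_toRep hρ hnontriv
  obtain ⟨φ, hφ, hequiv⟩ := O.exists_embedding P
  exact ⟨φ, hφ, hequiv, fun A v hv => O.apply_eq_of_orthogonal P hφ hequiv A hv⟩
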